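/- Let $n\ge 1$, let $W=\mathbb{R}^{1,n+2}$ with coordinates $(\lambda,u,x^1,\dots,x^n,t)$ and quadratic form $-\lambda^2+u^2+\|x\|^2+t^2$, and let $G=\mathrm{SO}(1,n+2)$ be the group of the linear isometries of $W$ of determinant $1$. It acts on the conformal sphere $\mathbb{S}^{n+1}$, the projectivised light cone of $W$, identified with the unit sphere $\{u^2+\|x\|^2+t^2=1\}$ by cutting the cone with $\lambda=1$, and on the spaces $J^l$ of $l$-jets of hypersurfaces of $\mathbb{S}^{n+1}$ by $g\cdot[S]^l_{p}=[g(S)]^l_{g(p)}$. Let $o=(0,0,1)$, let $S_{\mathcal F}=\{u=0\}\subset\mathbb{S}^{n+1}$ be the equator through $o$, and $o^{(l)}=[S_{\mathcal F}]^l_o$. The fibre of $J^2\to J^1$ over $o^{(1)}$ is an affine space over the quadratic forms on $T_oS_{\mathcal F}=\mathbb{R}^n$ (with values in the normal line, spanned by $\partial_u$). Let $R=\{g\cdot o^{(2)}-o^{(2)} : g\in G,\ g\cdot o^{(1)}=o^{(1)}\}$. The local coordinates $(u,x^1,\dots,x^n)$ of $\mathbb{S}^{n+1}\setminus\{-o\}$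 are those of the stereographic projection $(u,x,t)\mapsto \frac{2}{1+t}(u,x)$, and $(u,x^i,u_i,u_{ij})$ are the induced coordinates on $J^2$: the $2$-jet of the graph $u=\varphi(x)$ at the point over $x$ has $u_i=\partial_i\varphi(x)$, $u_{ij}=\partial_i\partial_j\varphi(x)$. For a trace-free quadratic form $q$ on $\mathbb{R}^n$ let $\lambda_1(q)\ge\dots\ge\lambda_n(q)$ be its eigenvalues (so $\sum_i\lambda_i(q)=0$). Let $f:\mathbb{R}^n\to\mathbb{R}$ be a function such that $\Sigma=\{q \text{ trace-free} : f(\lambda_1(q),\dots,\lambda_n(q))=0\}$ is invariant under $\mathrm{CO}(n)\times\mathbb{Z}_2$, where $\mathrm{CO}(n)=\mathbb{R}^+\cdot\mathrm{SO}(n)$ acts naturally on quadratic forms and $\mathbb{Z}_2$ acts by $\pm1$. Put $$\mathcal{E}_\Sigma=\{[S]^2_p\in J^2 : g\cdot[S]^2_p-o^{(2)}\in\Sigma+R \text{ for some } g\in G \text{ with } g\cdot[S]^1_p=o^{(1)}\}.$$ For a jet with coordinates $u_i,u_{ij}$ put $\rho=1+\sum_iu_i^2$ and $h_{ij}=\rho^{-2}(\rho\,\delta_{ij}-u_iu_j)$,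 let $A=\big(\sum_kh_{ik}u_{kj}\big)_{ij}$ (the endomorphism denoted $h^{-1}\circ\boldsymbol u$), and let $\mathring\tau_d=\operatorname{tr}\big((A-\tfrac1n\operatorname{tr}(A)\,\mathrm{id})^d\big)$ for $2\le d\le n$. At $u_i=0$ one has $h=\mathrm{id}$, so the $\mathring\tau_d$ are also functions of a trace-free quadratic form $q$, namely $\mathring\tau_d(q)=\operatorname{tr}(q^d)$. Then: 1. There is a function $\underline f$ of $n-1$ real variables such that $f(\lambda_1(q),\dots,\lambda_n(q))=\underline f(\mathring\tau_2(q),\dots,\mathring\tau_n(q))$ for all trace-free quadratic forms $q$, and its values at the points $(\mathring\tau_2(q),\dots,\mathring\tau_n(q))$ are unique. 2. $\mathcal{E}_\Sigma$ is well defined, i.e., the condition $g\cdot[S]^2_p-o^{(2)}\in\Sigma+R$ does not depend on the choice of $g\in G$ with $g\cdot[S]^1_p=o^{(1)}$, and it is $G$-invariant. 3. For every $\underline f$ as in 1, a $2$-jet with stereographic jet coordinates $(u,x^i,u_i,u_{ij})$ belongs to $\mathcal{E}_\Sigma$ if and only if $\underline f(\mathring\tau_2,\dots,\mathring\tau_n)=0$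 at $(u_i,u_{ij})$. -/

import Mathlib

open Filter Topology Manifold
open scoped ContDiff

noncomputable section

namespace ConfPDE

/-! ### The conformal sphere and the group `SO(1, n+2)` -/

/-- The space `ℝⁿ` of the independent variables `x = (x¹, …, xⁿ)`. -/
abbrev EX (n : ℕ) : Type := EuclideanSpace ℝ (Fin n)

/-- The space `ℝⁿ⁺²` with coordinates `(u, x¹, …, xⁿ, t)`. -/
abbrev V (n : ℕ) : Type := EuclideanSpace ℝ (Fin (n + 1 + 1))

/-- The sphere `𝕊ⁿ⁺¹`, the unit sphere of `V n`. -/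
abbrev Sph (n : ℕ) : Type := Metric.sphere (0 : V n) 1

instance finrankV (n : ℕ) : Fact (Module.finrank ℝ (V n) = (n + 1) + 1) :=
  ⟨finrank_euclideanSpace_fin⟩

/-- The space `W = ℝ^{1,n+2}`, with coordinates `(lam, (u, x, t))`. -/
abbrev W (n : ℕ) : Type := ℝ × V n

/-- The Lorentzian quadratic form `- lam² + u² + ‖x‖² + t²` on `W`. -/
def lorentz {n : ℕ} (w : W n) : ℝ := -w.1 ^ 2 + ‖w.2‖ ^ 2

/-- The group `SO(1, n+2)` of the linear isometries of `W` of determinant one. -/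
def SOW (n : ℕ) : Subgroup (W n ≃ₗ[ℝ] W n) where
  carrier := {A | (∀ w, lorentz (A w) = lorentz w) ∧ LinearEquiv.det A = 1}
  mul_mem' := by
    rintro A B ⟨hA, dA⟩ ⟨hB, dB⟩
    refine ⟨fun w => ?_, by rw [map_mul, dA, dB, one_mul]⟩
    rw [LinearEquiv.mul_apply, hA, hB]
  one_mem' := ⟨fun _ => rfl, map_one _⟩
  inv_mem' := by
    rintro A ⟨hA, dA⟩
    refine ⟨fun w => ?_, by rw [map_inv, dA, inv_one]⟩
    rw [← hA (A⁻¹ w)]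
    congr 1
    exact A.apply_symm_apply w

/-- The isotropic vector `(1, y)`; the sphere is identified with the projectivised light cone of
`W` by sending `y` to the line spanned by this vector. -/
def lift {n : ℕ} (y : Sph n) : W n := (1, (y : V n))

theorem norm_coe {n : ℕ} (y : Sph n) : ‖(y : V n)‖ = 1 := by simp

theorem lorentz_map_lift {n : ℕ} (A : SOW n) (y : Sph n) :
    ‖((A : W n ≃ₗ[ℝ] W n) (lift y)).2‖ ^ 2 = ((A : W n ≃ₗ[ℝ] W n) (lift y)).1 ^ 2 := by
  have h := A.2.1 (lift y)
  have h2 : lorentz (lift y) = 0 := by simp [lorentz, lift]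
  rw [h2] at h
  unfold lorentz at h
  linarith

theorem map_lift_ne {n : ℕ} (A : SOW n) (y : Sph n) :
    ((A : W n ≃ₗ[ℝ] W n) (lift y)).1 ≠ 0 := by
  intro h
  have h1 := lorentz_map_lift A y
  rw [h] at h1
  have h2 : ((A : W n ≃ₗ[ℝ] W n) (lift y)).2 = 0 := by simpa using h1
  have h3 : (A : W n ≃ₗ[ℝ] W n) (lift y) = 0 := Prod.ext h h2
  have h4 : lift y = 0 := (LinearEquiv.map_eq_zero_iff _).1 h3
  have h5 := congrArg Prod.fst h4
  simp [lift] at h5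

theorem actFun_mem {n : ℕ} (A : SOW n) (y : Sph n) :
    (((A : W n ≃ₗ[ℝ] W n) (lift y)).1)⁻¹ • ((A : W n ≃ₗ[ℝ] W n) (lift y)).2
      ∈ Metric.sphere (0 : V n) 1 := by
  have h1 := lorentz_map_lift A y
  have h2 : ‖((A : W n ≃ₗ[ℝ] W n) (lift y)).2‖ = |((A : W n ≃ₗ[ℝ] W n) (lift y)).1| := by
    rw [← abs_norm]
    exact (sq_eq_sq_iff_abs_eq_abs _ _).1 h1
  rw [mem_sphere_zero_iff_norm, norm_smul, h2, norm_inv, Real.norm_eq_abs]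
  exact inv_mul_cancel₀ (abs_ne_zero.2 (map_lift_ne A y))

/-- The action of `SO(1, n+2)` on the projectivised light cone, read on the sphere: `A • y` is the
point whose line is spanned by `A (1, y)`. -/
def actFun {n : ℕ} (A : SOW n) (y : Sph n) : Sph n :=
  ⟨(((A : W n ≃ₗ[ℝ] W n) (lift y)).1)⁻¹ • ((A : W n ≃ₗ[ℝ] W n) (lift y)).2, actFun_mem A y⟩

theorem lift_actFun {n : ℕ} (A : SOW n) (y : Sph n) :
    lift (actFun A y) =
      (((A : W n ≃ₗ[ℝ] W n) (lift y)).1)⁻¹ • (A : W n ≃ₗ[ℝ] W n) (lift y) := by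
  refine Prod.ext ?_ rfl
  exact (inv_mul_cancel₀ (map_lift_ne A y)).symm

theorem actFun_inv {n : ℕ} (A : SOW n) (y : Sph n) : actFun A⁻¹ (actFun A y) = y := by
  have hne := map_lift_ne A y
  have h : ((A⁻¹ : SOW n) : W n ≃ₗ[ℝ] W n) (lift (actFun A y)) =
      (((A : W n ≃ₗ[ℝ] W n) (lift y)).1)⁻¹ • lift y := by
    rw [lift_actFun, LinearEquiv.map_smul]
    congr 1
    exact (A : W n ≃ₗ[ℝ] W n).symm_apply_apply _
  apply Subtype.ext
  change ((((A⁻¹ : SOW n) : W n ≃ₗ[ℝ] W n) (lift (actFun A y))).1)⁻¹ •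
    (((A⁻¹ : SOW n) : W n ≃ₗ[ℝ] W n) (lift (actFun A y))).2 = _
  rw [h]
  have h1 : (lift y).1 = 1 := rfl
  rw [Prod.smul_fst, Prod.smul_snd, h1, smul_eq_mul, mul_one, inv_inv, smul_smul,
    mul_inv_cancel₀ hne, one_smul]
  rfl

theorem contMDiff_actFun {n : ℕ} (A : SOW n) :
    ContMDiff (𝓡 (n + 1)) (𝓡 (n + 1)) ∞ (actFun A : Sph n → Sph n) := by
  have hL : ContDiff ℝ ∞ (fun v : V n => (A : W n ≃ₗ[ℝ] W n) ((1 : ℝ), v)) :=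
    (LinearMap.toContinuousLinearMap ((A : W n ≃ₗ[ℝ] W n) : W n →ₗ[ℝ] W n)).contDiff.comp
      (contDiff_const.prodMk contDiff_id)
  have hc : ContMDiff (𝓡 (n + 1)) 𝓘(ℝ, V n) ∞ ((↑) : Sph n → V n) := contMDiff_coe_sphere
  have h1 : ContMDiff (𝓡 (n + 1)) 𝓘(ℝ, ℝ) ∞
      (fun y : Sph n => ((A : W n ≃ₗ[ℝ] W n) (lift y)).1) :=
    (contDiff_fst.comp hL).contMDiff.comp hc
  have h2 : ContMDiff (𝓡 (n + 1)) 𝓘(ℝ, V n) ∞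
      (fun y : Sph n => ((A : W n ≃ₗ[ℝ] W n) (lift y)).2) :=
    (contDiff_snd.comp hL).contMDiff.comp hc
  have h3 : ContMDiff (𝓡 (n + 1)) 𝓘(ℝ, ℝ) ∞
      (fun y : Sph n => (((A : W n ≃ₗ[ℝ] W n) (lift y)).1)⁻¹) := by
    intro y
    exact ((contDiffAt_inv ℝ (map_lift_ne A y)).contMDiffAt).comp y (h1 y)
  exact (h3.smul h2).codRestrict_sphere (actFun_mem A)

/-- An element of `SO(1, n+2)` as a homeomorphism of the sphere. -/
def actHomeo {n : ℕ} (A : SOW n) : Sph n ≃ₜ Sph n where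
  toFun := actFun A
  invFun := actFun A⁻¹
  left_inv := actFun_inv A
  right_inv y := by
    have h := actFun_inv A⁻¹ y
    rwa [inv_inv] at h
  continuous_toFun := (contMDiff_actFun A).continuous
  continuous_invFun := (contMDiff_actFun A⁻¹).continuous

/-! ### Charts, hypersurfaces and jets of hypersurfaces -/

/-- A chart `(u, x)` of the smooth manifold `𝕊ⁿ⁺¹`: a diffeomorphism of an open subset onto an open
subset of `ℝ × ℝⁿ`. -/
structure IsSmoothChart {n : ℕ} (φ : OpenPartialHomeomorph (Sph n) (ℝ × EX n)) : Prop where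
  smooth : ContMDiffOn (𝓡 (n + 1)) 𝓘(ℝ, ℝ × EX n) ∞ φ φ.source
  smooth_symm : ContMDiffOn 𝓘(ℝ, ℝ × EX n) (𝓡 (n + 1)) ∞ φ.symm φ.target

/-- Near the point `p`, the set `S` is the graph `u = f x` of a smooth function `f`, in the
coordinates `(u, x)`. -/
def IsGraphAt {n : ℕ} (φ : Sph n → ℝ × EX n) (S : Set (Sph n)) (p : Sph n) (f : EX n → ℝ) : Prop :=
  (∀ᶠ x in 𝓝 (φ p).2, ContDiffAt ℝ ∞ f x) ∧
    ∀ᶠ y in 𝓝 p, y ∈ S ↔ (φ y).1 = f (φ y).2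

/-- A hypersurface of the sphere passing through a given point, up to what happens far from that
point: a subset that contains the point and is an embedded smooth hypersurface near it, i.e., the
graph of a smooth function in a suitable chart. -/
structure Hyp (n : ℕ) where
  carrier : Set (Sph n)
  pt : Sph n
  mem : pt ∈ carrier
  isHyp : ∃ φ : OpenPartialHomeomorph (Sph n) (ℝ × EX n), IsSmoothChart φ ∧ pt ∈ φ.source ∧
    ∃ f, IsGraphAt φ carrier pt f

/-- Equality of the `l`-jets at `x` of two functions. -/
def SameJet {n : ℕ} (l : ℕ) (f g : EX n → ℝ) (x : EX n) : Prop :=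
  ∀ k ≤ l, iteratedFDeriv ℝ k f x = iteratedFDeriv ℝ k g x

/-- `l`-equivalence of two hypersurfaces through a common point: in some chart for which both are
admissible, they are the graphs of functions with the same `l`-jet. -/
def JetRel {n : ℕ} (l : ℕ) (S T : Hyp n) : Prop :=
  S.pt = T.pt ∧ ∃ φ : OpenPartialHomeomorph (Sph n) (ℝ × EX n), IsSmoothChart φ ∧
    S.pt ∈ φ.source ∧ ∃ f g, IsGraphAt φ S.carrier S.pt f ∧ IsGraphAt φ T.carrier S.pt g ∧
      SameJet l f g (φ S.pt).2

/-- The space `J^l(n, 𝕊ⁿ⁺¹)` of `l`-jets of hypersurfaces of the sphere. -/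
def Jet (l n : ℕ) : Type := Quot (JetRel (n := n) l)

/-- The `l`-jet `[S]^l_p` of a hypersurface `S` at its point `p`. -/
def jet {n : ℕ} (l : ℕ) (S : Hyp n) : Jet l n := Quot.mk _ S

/-- The projection `J² → J¹`. -/
def proj {n : ℕ} : Jet 2 n → Jet 1 n :=
  Quot.map id (by
    rintro S T ⟨h, φ, hφ, hm, f, g, hf, hg, hj⟩
    exact ⟨h, φ, hφ, hm, f, g, hf, hg, fun k hk => hj k (hk.trans one_le_two)⟩)

/-- The chart `φ` transported by `A`. -/
def moveChart {n : ℕ} (A : SOW n) (φ : OpenPartialHomeomorph (Sph n) (ℝ × EX n)) :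
    OpenPartialHomeomorph (Sph n) (ℝ × EX n) :=
  (actHomeo A).symm.toOpenPartialHomeomorph.trans φ

theorem isSmoothChart_moveChart {n : ℕ} (A : SOW n)
    {φ : OpenPartialHomeomorph (Sph n) (ℝ × EX n)} (hφ : IsSmoothChart φ) :
    IsSmoothChart (moveChart A φ) := by
  constructor
  · have h : ContMDiffOn (𝓡 (n + 1)) (𝓡 (n + 1)) ∞ (actFun A⁻¹ : Sph n → Sph n)
        (moveChart A φ).source := (contMDiff_actFun A⁻¹).contMDiffOn
    refine hφ.smooth.comp h ?_
    intro y hy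
    have hy' : y ∈ (moveChart A φ).source := hy
    rw [moveChart, OpenPartialHomeomorph.trans_source] at hy'
    exact hy'.2
  · have h : ContMDiffOn 𝓘(ℝ, ℝ × EX n) (𝓡 (n + 1)) ∞ φ.symm (moveChart A φ).target := by
      refine hφ.smooth_symm.mono ?_
      intro z hz
      have hz' : z ∈ (moveChart A φ).target := hz
      rw [moveChart, OpenPartialHomeomorph.trans_target] at hz'
      exact hz'.1
    exact (contMDiff_actFun A).comp_contMDiffOn h

theorem mem_moveChart {n : ℕ} (A : SOW n) {φ : OpenPartialHomeomorph (Sph n) (ℝ × EX n)}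
    {p : Sph n} (hp : p ∈ φ.source) : actFun A p ∈ (moveChart A φ).source := by
  rw [moveChart, OpenPartialHomeomorph.trans_source]
  refine ⟨Set.mem_univ _, ?_⟩
  change actFun A⁻¹ (actFun A p) ∈ φ.source
  rwa [actFun_inv]

theorem moveChart_apply {n : ℕ} (A : SOW n) (φ : OpenPartialHomeomorph (Sph n) (ℝ × EX n))
    (p : Sph n) : moveChart A φ (actFun A p) = φ p := by
  change φ (actFun A⁻¹ (actFun A p)) = φ p
  rw [actFun_inv]

theorem isGraphAt_moveChart {n : ℕ} (A : SOW n) {φ : OpenPartialHomeomorph (Sph n) (ℝ × EX n)}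
    {S : Set (Sph n)} {p : Sph n} {f : EX n → ℝ} (h : IsGraphAt φ S p f) :
    IsGraphAt (moveChart A φ) (actFun A '' S) (actFun A p) f := by
  refine ⟨by rw [moveChart_apply]; exact h.1, ?_⟩
  have ht : Tendsto (actFun A⁻¹) (𝓝 (actFun A p)) (𝓝 p) := by
    have := (contMDiff_actFun A⁻¹).continuous.tendsto (actFun A p)
    rwa [actFun_inv] at this
  filter_upwards [ht.eventually h.2] with y hy
  have hy2 : actFun A (actFun A⁻¹ y) = y := (actHomeo A).right_inv y
  have : y ∈ actFun A '' S ↔ actFun A⁻¹ y ∈ S := by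
    constructor
    · rintro ⟨z, hz, rfl⟩
      rwa [actFun_inv]
    · intro hz
      exact ⟨_, hz, hy2⟩
  rw [this, hy]
  rfl

/-- The image of a hypersurface under an element of `SO(1, n+2)`. -/
def moveHyp {n : ℕ} (A : SOW n) (S : Hyp n) : Hyp n where
  carrier := actFun A '' S.carrier
  pt := actFun A S.pt
  mem := ⟨_, S.mem, rfl⟩
  isHyp := by
    obtain ⟨φ, hφ, hm, f, hf⟩ := S.isHyp
    exact ⟨moveChart A φ, isSmoothChart_moveChart A hφ, mem_moveChart A hm, f,
      isGraphAt_moveChart A hf⟩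

/-- The prolonged action `A • [S]^l_p = [A(S)]^l_{A(p)}` on the jet spaces. -/
def act {n : ℕ} {l : ℕ} (A : SOW n) : Jet l n → Jet l n :=
  Quot.map (moveHyp A) (by
    rintro S T ⟨h, φ, hφ, hm, f, g, hf, hg, hj⟩
    refine ⟨congrArg (actFun A) h, moveChart A φ, isSmoothChart_moveChart A hφ,
      mem_moveChart A hm, f, g, isGraphAt_moveChart A hf, isGraphAt_moveChart A hg, ?_⟩
    change SameJet l f g (moveChart A φ (actFun A S.pt)).2
    rw [moveChart_apply]
    exact hj)

/-! ### Stereographic coordinates -/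

/-- The coordinate `u` of a vector `(u, x, t)`. -/
def cu {n : ℕ} (v : V n) : ℝ := v 0

/-- The coordinates `x` of a vector `(u, x, t)`. -/
def cx {n : ℕ} (v : V n) : EX n := WithLp.toLp 2 fun i : Fin n => v i.castSucc.succ

/-- The coordinate `t` of a vector `(u, x, t)`. -/
def ct {n : ℕ} (v : V n) : ℝ := v (Fin.last (n + 1))

/-- The vector `(u, x, t)`. -/
def mkV {n : ℕ} (u : ℝ) (x : EX n) (t : ℝ) : V n :=
  WithLp.toLp 2 (Fin.cons u (Fin.snoc (fun i => x i) t : Fin (n + 1) → ℝ) : Fin (n + 1 + 1) → ℝ)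

@[simp] theorem cu_mkV {n : ℕ} (u : ℝ) (x : EX n) (t : ℝ) : cu (mkV u x t) = u := rfl

@[simp] theorem cx_mkV {n : ℕ} (u : ℝ) (x : EX n) (t : ℝ) : cx (mkV u x t) = x := by
  ext i
  simp [cx, mkV]

@[simp] theorem ct_mkV {n : ℕ} (u : ℝ) (x : EX n) (t : ℝ) : ct (mkV u x t) = t := by
  unfold ct mkV
  rw [← Fin.succ_last]
  simp

theorem mkV_eta {n : ℕ} (v : V n) : mkV (cu v) (cx v) (ct v) = v := by
  ext i
  refine Fin.cases ?_ (fun j => ?_) i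
  · rfl
  · refine Fin.lastCases ?_ (fun k => ?_) j
    · simp [mkV, ct]
    · simp [mkV, cx]

theorem normSq_mkV {n : ℕ} (u : ℝ) (x : EX n) (t : ℝ) :
    ‖mkV u x t‖ ^ 2 = u ^ 2 + ‖x‖ ^ 2 + t ^ 2 := by
  rw [EuclideanSpace.real_norm_sq_eq, EuclideanSpace.real_norm_sq_eq, Fin.sum_univ_succ,
    Fin.sum_univ_castSucc]
  simp [mkV]
  ring

theorem sph_eq {n : ℕ} (y : Sph n) :
    cu (y : V n) ^ 2 + ‖cx (y : V n)‖ ^ 2 + ct (y : V n) ^ 2 = 1 := by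
  rw [← normSq_mkV, mkV_eta, norm_coe, one_pow]

/-- The point of coordinates `(u, x, t)` goes to `2 (u, x) / (1 + t)`: this is the stereographic
projection from `- e₊ = (0, 0, -1)` to the hyperplane tangent to the sphere at `e₊ = (0, 0, 1)`. -/
def stereoFun {n : ℕ} (y : Sph n) : ℝ × EX n :=
  ((2 / (1 + ct (y : V n))) * cu (y : V n), (2 / (1 + ct (y : V n))) • cx (y : V n))

/-- The ambient formula for the inverse of the stereographic projection. -/
def stereoInvAux {n : ℕ} (z : ℝ × EX n) : V n :=
  (4 + (z.1 ^ 2 + ‖z.2‖ ^ 2))⁻¹ • mkV (4 * z.1) ((4 : ℝ) • z.2) (4 - (z.1 ^ 2 + ‖z.2‖ ^ 2))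

theorem stereo_den_pos {n : ℕ} (z : ℝ × EX n) : 0 < 4 + (z.1 ^ 2 + ‖z.2‖ ^ 2) := by positivity

theorem smul_mkV {n : ℕ} (c u : ℝ) (x : EX n) (t : ℝ) :
    c • mkV u x t = mkV (c * u) (c • x) (c * t) := by
  rw [← mkV_eta (c • mkV u x t)]
  congr 1
  · ext i
    simp [cx, mkV]
  · unfold ct mkV
    rw [← Fin.succ_last]
    simp

theorem stereoInvAux_mem {n : ℕ} (z : ℝ × EX n) :
    stereoInvAux z ∈ Metric.sphere (0 : V n) 1 := by
  have h := stereo_den_pos z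
  rw [mem_sphere_zero_iff_norm]
  have h2 : ‖stereoInvAux z‖ ^ 2 = 1 := by
    rw [stereoInvAux, smul_mkV, normSq_mkV, norm_smul, norm_smul]
    simp only [norm_inv, Real.norm_eq_abs, abs_of_pos h]
    norm_num
    field_simp
    ring
  nlinarith [norm_nonneg (stereoInvAux z)]

/-- The inverse of the stereographic projection. -/
def stereoInv {n : ℕ} (z : ℝ × EX n) : Sph n := ⟨stereoInvAux z, stereoInvAux_mem z⟩

theorem contDiff_cu {n : ℕ} : ContDiff ℝ ∞ (cu : V n → ℝ) := by
  unfold cu; fun_prop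

theorem contDiff_ct {n : ℕ} : ContDiff ℝ ∞ (ct : V n → ℝ) := by
  unfold ct; fun_prop

theorem contDiff_cx {n : ℕ} : ContDiff ℝ ∞ (cx : V n → EX n) := by
  rw [contDiff_euclidean]
  intro i
  change ContDiff ℝ ∞ fun v : V n => v i.castSucc.succ
  fun_prop

theorem contDiff_mkV {n : ℕ} :
    ContDiff ℝ ∞ (fun z : ℝ × EX n × ℝ => (mkV z.1 z.2.1 z.2.2 : V n)) := by
  rw [contDiff_euclidean]
  intro i
  refine Fin.cases ?_ (fun j => ?_) i
  · exact contDiff_fst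
  · refine Fin.lastCases ?_ (fun k => ?_) j
    · simp only [mkV, Fin.cons_succ, Fin.snoc_last]
      fun_prop
    · simp only [mkV, Fin.cons_succ, Fin.snoc_castSucc]
      fun_prop

theorem contDiff_stereoInvAux {n : ℕ} : ContDiff ℝ ∞ (stereoInvAux : ℝ × EX n → V n) := by
  have hq : ContDiff ℝ ∞ (fun z : ℝ × EX n => z.1 ^ 2 + ‖z.2‖ ^ 2) :=
    (contDiff_fst.pow 2).add (contDiff_snd.norm_sq ℝ)
  have h1 : ContDiff ℝ ∞ (fun z : ℝ × EX n => (4 + (z.1 ^ 2 + ‖z.2‖ ^ 2))⁻¹) :=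
    (contDiff_const.add hq).inv fun z => (stereo_den_pos z).ne'
  refine h1.smul ?_
  exact contDiff_mkV.comp ((contDiff_const.mul contDiff_fst).prodMk
    ((contDiff_snd.const_smul (4 : ℝ)).prodMk (contDiff_const.sub hq)))

theorem contMDiff_stereoInv {n : ℕ} :
    ContMDiff 𝓘(ℝ, ℝ × EX n) (𝓡 (n + 1)) ∞ (stereoInv : ℝ × EX n → Sph n) :=
  (contDiff_stereoInvAux.contMDiff).codRestrict_sphere stereoInvAux_mem

theorem contMDiffOn_stereoFun {n : ℕ} :
    ContMDiffOn (𝓡 (n + 1)) 𝓘(ℝ, ℝ × EX n) ∞ (stereoFun : Sph n → ℝ × EX n)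
      {y | ct (y : V n) ≠ -1} := by
  have h : ContDiffOn ℝ ∞ (fun v : V n => ((2 / (1 + ct v)) * cu v, (2 / (1 + ct v)) • cx v))
      {v | ct v ≠ -1} := by
    have hd : ContDiffOn ℝ ∞ (fun v : V n => 2 / (1 + ct v)) {v | ct v ≠ -1} := by
      refine contDiffOn_const.div (contDiff_const.add contDiff_ct).contDiffOn ?_
      intro v hv hz
      exact hv (by linarith)
    exact (hd.mul contDiff_cu.contDiffOn).prodMk (hd.smul contDiff_cx.contDiffOn)
  have hc : ContMDiff (𝓡 (n + 1)) 𝓘(ℝ, V n) ∞ ((↑) : Sph n → V n) := contMDiff_coe_sphere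
  exact h.contMDiffOn.comp hc.contMDiffOn fun y hy => hy

theorem one_add_ct_ne {n : ℕ} {y : Sph n} (hy : ct (y : V n) ≠ -1) : 1 + ct (y : V n) ≠ 0 :=
  fun h => hy (by linarith)

theorem stereoInv_stereoFun {n : ℕ} {y : Sph n} (hy : ct (y : V n) ≠ -1) :
    stereoInv (stereoFun y) = y := by
  have h0 := one_add_ct_ne hy
  have h1 := sph_eq y
  apply Subtype.ext
  change stereoInvAux (stereoFun y) = (y : V n)
  conv_rhs => rw [← mkV_eta (y : V n)]
  have hr : (stereoFun y).1 ^ 2 + ‖(stereoFun y).2‖ ^ 2 =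
      4 * (1 - ct (y : V n)) / (1 + ct (y : V n)) := by
    simp only [stereoFun, norm_smul, mul_pow, Real.norm_eq_abs, sq_abs]
    have : ‖cx (y : V n)‖ ^ 2 = 1 - cu (y : V n) ^ 2 - ct (y : V n) ^ 2 := by linarith
    rw [this]
    field_simp
    ring
  have hd : 4 + 4 * (1 - ct (y : V n)) / (1 + ct (y : V n)) = 8 / (1 + ct (y : V n)) := by
    field_simp
    ring
  rw [stereoInvAux, smul_mkV, hr, hd]
  congr 1
  · simp only [stereoFun]
    field_simp
    norm_num
  · simp only [stereoFun, smul_smul]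
    have : (8 / (1 + ct (y : V n)))⁻¹ * (4 * (2 / (1 + ct (y : V n)))) = 1 := by
      field_simp
      norm_num
    rw [this, one_smul]
  · field_simp
    ring

theorem stereoInv_mem {n : ℕ} (z : ℝ × EX n) : ct ((stereoInv z : Sph n) : V n) ≠ -1 := by
  have h := stereo_den_pos z
  change ct (stereoInvAux z) ≠ -1
  rw [stereoInvAux, smul_mkV, ct_mkV]
  intro h2
  field_simp at h2
  linarith

theorem stereoFun_stereoInv {n : ℕ} (z : ℝ × EX n) : stereoFun (stereoInv z) = z := by
  have h := stereo_den_pos z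
  have ht : 1 + ct (stereoInvAux z) = 8 / (4 + (z.1 ^ 2 + ‖z.2‖ ^ 2)) := by
    rw [stereoInvAux, smul_mkV, ct_mkV]
    field_simp
    ring
  change ((2 / (1 + ct (stereoInvAux z))) * cu (stereoInvAux z),
    (2 / (1 + ct (stereoInvAux z))) • cx (stereoInvAux z)) = z
  rw [ht, stereoInvAux, smul_mkV, cu_mkV, cx_mkV]
  refine Prod.ext ?_ ?_
  · simp only
    field_simp
    norm_num
  · simp only [smul_smul]
    have : 2 / (8 / (4 + (z.1 ^ 2 + ‖z.2‖ ^ 2))) * ((4 + (z.1 ^ 2 + ‖z.2‖ ^ 2))⁻¹ * 4) = 1 := by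
      field_simp
      norm_num
    rw [this, one_smul]

/-- The stereographic chart `(u, x)` of the sphere, defined outside the point `- e₊`. -/
def stereo (n : ℕ) : OpenPartialHomeomorph (Sph n) (ℝ × EX n) where
  toFun := stereoFun
  invFun := stereoInv
  source := {y | ct (y : V n) ≠ -1}
  target := Set.univ
  map_source' := fun _ _ => Set.mem_univ _
  map_target' := fun z _ => stereoInv_mem z
  left_inv' := fun _ hy => stereoInv_stereoFun hy
  right_inv' := fun z _ => stereoFun_stereoInv z
  open_source := isOpen_ne_fun (contDiff_ct.continuous.comp continuous_subtype_val)
    continuous_const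
  open_target := isOpen_univ
  continuousOn_toFun := contMDiffOn_stereoFun.continuousOn
  continuousOn_invFun := contMDiff_stereoInv.continuous.continuousOn

theorem isSmoothChart_stereo (n : ℕ) : IsSmoothChart (stereo n) :=
  ⟨contMDiffOn_stereoFun, contMDiff_stereoInv.contMDiffOn⟩

/-- The 2-jet `j` has the standard jet coordinates `(u, x, p, U) = (u, xⁱ, u_i, u_ij)` induced by
the stereographic coordinates: it is the 2-jet of a hypersurface which is the graph of a function
`f` in the stereographic chart, `u = f x`, and `p`, `U` are the first and second partial derivatives
of `f` at `x`. -/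
def HasCoords {n : ℕ} (j : Jet 2 n) (u : ℝ) (x : EX n) (p : Fin n → ℝ)
    (U : Matrix (Fin n) (Fin n) ℝ) : Prop :=
  ∃ (S : Hyp n) (f : EX n → ℝ), j = jet 2 S ∧ S.pt ∈ (stereo n).source ∧
    stereo n S.pt = (u, x) ∧ IsGraphAt (stereo n) S.carrier S.pt f ∧
    (∀ i, p i = fderiv ℝ f x (EuclideanSpace.single i 1)) ∧
    ∀ i k, U i k =
      iteratedFDeriv ℝ 2 f x ![EuclideanSpace.single i 1, EuclideanSpace.single k 1]

/-! ### The fiducial hypersurface and its orbit -/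

theorem single_last_mem (n : ℕ) : mkV 0 (0 : EX n) 1 ∈ Metric.sphere (0 : V n) 1 := by
  rw [mem_sphere_zero_iff_norm]
  have h := normSq_mkV 0 (0 : EX n) 1
  simp only [norm_zero] at h
  norm_num at h
  rcases h with h | h
  · exact h
  · linarith [norm_nonneg (mkV 0 (0 : EX n) 1)]

/-- The origin `o = e₊`, i.e., the line spanned by the isotropic vector `e₋ + e₊`. -/
def origin (n : ℕ) : Sph n := ⟨mkV 0 0 1, single_last_mem n⟩

/-- The fiducial hypersurface, the equator orthogonal to `e₀`, with its point `o`. -/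
def fiducial (n : ℕ) : Hyp n where
  carrier := {y | cu (y : V n) = 0}
  pt := origin n
  mem := cu_mkV _ _ _
  isHyp := by
    have hs : origin n ∈ (stereo n).source := by
      change ct (mkV 0 (0 : EX n) 1) ≠ -1
      rw [ct_mkV]
      norm_num
    refine ⟨stereo n, isSmoothChart_stereo n, hs, fun _ => 0, ?_, ?_⟩
    · exact Eventually.of_forall fun _ => contDiffAt_const
    · filter_upwards [(stereo n).open_source.mem_nhds hs] with y hy
      have h0 := one_add_ct_ne (y := y) hy
      change cu (y : V n) = 0 ↔ (2 / (1 + ct (y : V n))) * cu (y : V n) = 0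
      simp [h0]

/-- The 1-jet `o⁽¹⁾` of the fiducial hypersurface at the origin. -/
def o1 (n : ℕ) : Jet 1 n := jet 1 (fiducial n)

/-- The 2-jet `o⁽²⁾` of the fiducial hypersurface at the origin. -/
def o2 (n : ℕ) : Jet 2 n := jet 2 (fiducial n)

/-- `j - k = v` in the affine structure of the fibres of `J² → J¹`: the 2-jets `j`, `k` have the
same coordinates of order less than two, and `v` is the difference of their second derivatives.
The quadratic form with values in the normal line is written in the bases `∂_{xⁱ}` of the tangent
hyperplane and `∂_u` of the normal line. -/
def IsDiff {n : ℕ} (j k : Jet 2 n) (v : Matrix (Fin n) (Fin n) ℝ) : Prop :=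
  ∃ u x p U U', HasCoords j u x p U ∧ HasCoords k u x p U' ∧ v = U - U'

/-- The set `R` of the differences `h • o⁽²⁾ - o⁽²⁾`, where `h` runs in the stabiliser of `o⁽¹⁾`:
the linear space on which the orbit of `o⁽²⁾` under this stabiliser is modelled. -/
def fiberR (n : ℕ) : Set (Matrix (Fin n) (Fin n) ℝ) :=
  {v | ∃ g : SOW n, act g (o1 n) = o1 n ∧ IsDiff (act g (o2 n)) (o2 n) v}

/-! ### Trace-free quadratic forms and the invariant equation -/

/-- The space of the trace-free quadratic forms on `ℝⁿ`, the tangent space at `o` of the fiducial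
hypersurface. -/
def TraceFree (n : ℕ) : Submodule ℝ (Matrix (Fin n) (Fin n) ℝ) where
  carrier := {q | q.IsSymm ∧ q.trace = 0}
  add_mem' := fun ha hb => ⟨ha.1.add hb.1, by rw [Matrix.trace_add, ha.2, hb.2, add_zero]⟩
  zero_mem' := ⟨Matrix.isSymm_zero, Matrix.trace_zero _ _⟩
  smul_mem' := fun c _ ha => ⟨ha.1.smul c, by rw [Matrix.trace_smul, ha.2, smul_zero]⟩

theorem TraceFree.isHermitian {n : ℕ} (q : TraceFree n) :
    (q : Matrix (Fin n) (Fin n) ℝ).IsHermitian := by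
  have h : (q : Matrix (Fin n) (Fin n) ℝ).IsSymm := q.2.1
  rw [Matrix.IsHermitian, Matrix.conjTranspose_eq_transpose_of_trivial]
  exact h

/-- The eigenvalues `λ₁ ≥ … ≥ λₙ` of a trace-free quadratic form, with multiplicities. -/
def eig {n : ℕ} (q : TraceFree n) (i : Fin n) : ℝ :=
  (TraceFree.isHermitian q).eigenvalues₀ (i.cast (Fintype.card_fin n).symm)

/-- The action `q ↦ q ∘ B⁻¹` of the rotations on the trace-free quadratic forms. -/
def rot {n : ℕ} (B : Matrix.specialOrthogonalGroup (Fin n) ℝ) (q : TraceFree n) : TraceFree n :=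
  ⟨B.1 * q.1 * B.1.transpose, by
    have hB : B.1.transpose * B.1 = 1 := (Matrix.mem_specialOrthogonalGroup_iff.1 B.2).1.1
    have hs : (q : Matrix (Fin n) (Fin n) ℝ).IsSymm := q.2.1
    refine ⟨?_, ?_⟩
    · rw [Matrix.IsSymm, Matrix.transpose_mul, Matrix.transpose_mul, Matrix.transpose_transpose,
        hs.eq, Matrix.mul_assoc]
    · rw [Matrix.trace_mul_comm, ← Matrix.mul_assoc, hB, Matrix.one_mul]
      exact q.2.2⟩

/-- Invariance of a set of trace-free quadratic forms under `CO(n) × ℤ₂`, where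
`CO(n) = ℝ⁺ · SO(n)` and `ℤ₂` acts by `± 1`. -/
def IsCOZ2Invariant {n : ℕ} (s : Set (TraceFree n)) : Prop :=
  ∀ q ∈ s, ∀ (B : Matrix.specialOrthogonalGroup (Fin n) ℝ) (c : ℝ), 0 < c →
    c • rot B q ∈ s ∧ -(c • rot B q) ∈ s

/-- The set of the trace-free quadratic forms `q` such that `f (λ₁(q), …, λₙ(q)) = 0`. -/
def zeroSet {n : ℕ} (f : (Fin n → ℝ) → ℝ) : Set (TraceFree n) := {q | f (eig q) = 0}

/-- The 2-jet `j` satisfies `j - o⁽²⁾ ∈ s + R`. -/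
def InFiber {n : ℕ} (s : Set (TraceFree n)) (j : Jet 2 n) : Prop :=
  ∃ q ∈ s, ∃ r ∈ fiberR n, IsDiff j (o2 n) ((q : Matrix (Fin n) (Fin n) ℝ) + r)

/-- The second order PDE associated with the set `s` of trace-free quadratic forms: the set of the
2-jets `j` such that `g • j - o⁽²⁾ ∈ s + R` for an element `g` of `SO(1, n+2)` which sends the
1-jet below `j` to `o⁽¹⁾`. -/
def PDE {n : ℕ} (s : Set (TraceFree n)) : Set (Jet 2 n) :=
  {j | ∃ g : SOW n, act g (proj j) = o1 n ∧ InFiber s (act g j)}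

/-! ### The invariants of the trace-free part -/

/-- The metric `h = ρ⁻² (ρ ∑ du_i² - (∑ u_i du_i)²)`, with `ρ = 1 + ∑ u_i²`: the pull-back, in the
coordinates `u_i`, of the round metric of the unit sphere by the central projection. -/
def hMetric {n : ℕ} (p : Fin n → ℝ) : Matrix (Fin n) (Fin n) ℝ :=
  ((1 + ∑ i, p i ^ 2) ^ 2)⁻¹ •
    ((1 + ∑ i, p i ^ 2) • (1 : Matrix (Fin n) (Fin n) ℝ) - Matrix.vecMulVec p p)

/-- The endomorphism obtained from `(u_ij)` by means of `h`. Here `(u_ij)` is the contravariant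
tensor `u_ij ∂_{u_i} ∂_{u_j}`, so that its index is moved by the contraction with `h`. -/
def shape {n : ℕ} (p : Fin n → ℝ) (U : Matrix (Fin n) (Fin n) ℝ) : Matrix (Fin n) (Fin n) ℝ :=
  hMetric p * U

/-- The trace-free part of an endomorphism. -/
def traceFreePart {n : ℕ} (A : Matrix (Fin n) (Fin n) ℝ) : Matrix (Fin n) (Fin n) ℝ :=
  A - (A.trace / n) • (1 : Matrix (Fin n) (Fin n) ℝ)

/-- The functions `τ_d`, for `2 ≤ d ≤ n`: the traces of the powers of the trace-free part. -/
def tau {n : ℕ} (p : Fin n → ℝ) (U : Matrix (Fin n) (Fin n) ℝ) (d : Finset.Icc 2 n) : ℝ :=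
  (traceFreePart (shape p U) ^ (d : ℕ)).trace

/-- `F ∘ (τ₂, …, τₙ) = f ∘ (λ₁, …, λₙ)` on the trace-free quadratic forms, where the `τ_d` are
evaluated over `o⁽¹⁾`, that is, at `u_i = 0`. -/
def Represents {n : ℕ} (F : (Finset.Icc 2 n → ℝ) → ℝ) (f : (Fin n → ℝ) → ℝ) : Prop :=
  ∀ q : TraceFree n, f (eig q) = F (tau 0 (q : Matrix (Fin n) (Fin n) ℝ))

end ConfPDE

end

open ConfPDE

open Filter Topology Manifold
open scoped ContDiff

noncomputable section

namespace ConfPDE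

/-! ### Taylor expansions of order two -/

section Taylor

variable {E : Type*} [NormedAddCommGroup E] [NormedSpace ℝ E]

/-! The light cone linearises the problem. The null vector `cone z` over the point of stereographic
coordinates `z` is a quadratic polynomial in `z`, its differential `dcone z` is a similarity onto
its image for the Lorentzian form, and its second order term always points along the fixed null
vector `eminus` (`cone_add`). An element `g` acts on the chart by applying `g` to `cone z` and
dividing by the null coordinate `wd` (`stereoFun_actFun`).

Let `g` carry the tangent hyperplane of a graph, with gradient `p` and Hessian `U`, to that of the
equator at `o`. Expanding to order two shows that the image is the graph of a function with a
critical point at `0` and Hessian `c NᵀUN + m·1`, with `c ≠ 0` and `N Nᵀ` a positive multiple of `(1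
+ p pᵀ)⁻¹` (`exists_image_graph`, `hasCoords_act`). Here `N` is the inverse of the differential of
the parametrised image, a similarity because `g` is conformal, and `m·1` comes from the quadratic
term of `cone`.

For the equator itself `U = 0`, so `R` consists of multiples of the identity; null translations
realise all of them (`fiberR_eq`). Hence membership in `Σ + R` only sees the trace-free part of
`NᵀUN`, up to a nonzero factor that the invariance of `Σ` absorbs. By the Sherman–Morrison formula
`h` is also a positive multiple of `(1 + p pᵀ)⁻¹`, so `hU` is similar to a positive multiple of
`NᵀUN`, and the traces of the powers of the trace-free parts agree up to that scaling. By Newton's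
identities these traces determine the ordered eigenvalues (`eig_eq_of_tau_eq`), so the condition
reads `F (tau p U) = 0`, in which `g` no longer appears (`inFiber_act_iff`).

A preliminary point is that the coordinates of a jet are well defined. Jets are classes for the
equivalence generated by a relation whose chart may change at each step. The relation `Contact`,
expressed in the stereographic chart alone, is transitive, follows from equality of jets in any
chart, and recovers the derivatives of stereographic graphs (`contact_of_jet_eq`,
`isLittleO_of_contact`, `HasCoords.unique`). -/

theorem taylor_two_isLittleO {f : E → ℝ} {x₀ : E} (hf : ContDiffAt ℝ 2 f x₀) :
    (fun x => f x - f x₀ - fderiv ℝ f x₀ (x - x₀) -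
      (1 / 2) * fderiv ℝ (fderiv ℝ f) x₀ (x - x₀) (x - x₀)) =o[𝓝 x₀] fun x => ‖x - x₀‖ ^ 2 := by
  have hsymm : IsSymmSndFDerivAt ℝ f x₀ := hf.isSymmSndFDerivAt (by simp)
  have hd : DifferentiableAt ℝ (fderiv ℝ f) x₀ :=
    (hf.fderiv_right (m := 1) (by norm_num)).differentiableAt (by norm_num)
  have hev : ∀ᶠ x in 𝓝 x₀, DifferentiableAt ℝ f x :=
    (hf.eventually (by simp)).mono fun x hx => hx.differentiableAt (by norm_num)
  obtain ⟨r, hr, hball⟩ := Metric.eventually_nhds_iff_ball.1 hev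
  set D := fderiv ℝ (fderiv ℝ f) x₀ with hD
  -- By symmetry of `D`, the differential of the order two remainder is the order one remainder of
  -- `fderiv ℝ f`, which is `o(‖x - x₀‖)`; integrating over the convex ball gains one power.
  have hderiv : ∀ x ∈ Metric.ball x₀ r, HasFDerivWithinAt
      (fun x => f x - fderiv ℝ f x₀ (x - x₀) - (1 / 2) * D (x - x₀) (x - x₀))
      (fderiv ℝ f x - fderiv ℝ f x₀ - D (x - x₀)) (Metric.ball x₀ r) x := by
    intro x hx
    have h1 := (hball x hx).hasFDerivAt
    have hs : HasFDerivAt (fun x : E => x - x₀) (ContinuousLinearMap.id ℝ E) x :=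
      (hasFDerivAt_id x).sub_const x₀
    have h2 : HasFDerivAt (fun x => fderiv ℝ f x₀ (x - x₀)) (fderiv ℝ f x₀) x := by
      exact (fderiv ℝ f x₀).hasFDerivAt.comp x hs
    have h3 := ((D.hasFDerivAt.comp x hs).clm_apply hs).const_mul (1 / 2 : ℝ)
    refine (((h1.sub h2).sub h3).congr_fderiv ?_).hasFDerivWithinAt
    ext v
    have := hsymm v (x - x₀)
    simp only [← hD, map_sub, sub_apply] at this
    simp
    linarith
  have hlo : (fun x => fderiv ℝ f x - fderiv ℝ f x₀ - D (x - x₀))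
      =o[𝓝[Metric.ball x₀ r] x₀] fun x => ‖x - x₀‖ ^ 1 := by
    have := (hd.hasFDerivAt.isLittleO).mono (nhdsWithin_le_nhds (s := Metric.ball x₀ r))
    simpa using this.norm_right
  have := (convex_ball x₀ r).isLittleO_pow_succ (Metric.mem_ball_self hr) hderiv hlo
  rw [nhdsWithin_eq_nhds.2 (Metric.ball_mem_nhds x₀ hr)] at this
  refine this.congr_left fun x => ?_
  simp
  ring

theorem isLittleO_comp_line {g : E → ℝ} {x₀ : E} {l : ℕ}
    (h : g =o[𝓝 x₀] fun x => ‖x - x₀‖ ^ l) (ξ : E) :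
    (fun t : ℝ => g (x₀ + t • ξ)) =o[𝓝 0] fun t => t ^ l := by
  have hc : Tendsto (fun t : ℝ => x₀ + t • ξ) (𝓝 0) (𝓝 x₀) := by
    have : Continuous fun t : ℝ => x₀ + t • ξ := by fun_prop
    simpa using this.tendsto 0
  refine (h.comp_tendsto hc).trans_isBigO ?_
  refine Asymptotics.IsBigO.of_bound (‖ξ‖ ^ l) (Eventually.of_forall fun t => ?_)
  simp [norm_smul, mul_pow, mul_comm]

theorem quadratic_coeff_eq_zero {a b c : ℝ}
    (h : (fun t : ℝ => a + t * b + t ^ 2 * c) =o[𝓝 0] fun t => t ^ 2) :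
    a = 0 ∧ b = 0 ∧ c = 0 := by
  have ha : a = 0 := by
    have h0 : Tendsto (fun t : ℝ => a + t * b + t ^ 2 * c) (𝓝 0) (𝓝 0) := by
      refine h.trans_tendsto ?_
      have : Continuous fun t : ℝ => t ^ 2 := by fun_prop
      simpa using this.tendsto 0
    have h1 : Tendsto (fun t : ℝ => a + t * b + t ^ 2 * c) (𝓝 0) (𝓝 a) := by
      have : Continuous fun t : ℝ => a + t * b + t ^ 2 * c := by fun_prop
      simpa using this.tendsto 0
    exact tendsto_nhds_unique h1 h0
  subst ha
  have hne : ∀ᶠ t : ℝ in 𝓝[≠] 0, t ≠ 0 := eventually_mem_nhdsWithin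
  have key := (h.mono (nhdsWithin_le_nhds (s := {0}ᶜ))).tendsto_div_nhds_zero
  have hb : b = 0 := by
    have h0 : Tendsto (fun t : ℝ => b + t * c) (𝓝[≠] 0) (𝓝 0) := by
      have h2 : Tendsto (fun t : ℝ => t * ((0 + t * b + t ^ 2 * c) / t ^ 2)) (𝓝[≠] 0) (𝓝 0) := by
        have h3 : Tendsto (fun t : ℝ => t) (𝓝[≠] 0) (𝓝 0) := tendsto_id.mono_left nhdsWithin_le_nhds
        simpa using h3.mul key
      refine h2.congr' ?_
      filter_upwards [hne] with t ht
      field_simp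
      ring
    have h1 : Tendsto (fun t : ℝ => b + t * c) (𝓝[≠] 0) (𝓝 b) := by
      have : Continuous fun t : ℝ => b + t * c := by fun_prop
      simpa using (this.tendsto 0).mono_left (nhdsWithin_le_nhds (s := {0}ᶜ))
    exact tendsto_nhds_unique h1 h0
  subst hb
  refine ⟨rfl, rfl, ?_⟩
  have h1 : Tendsto (fun _ : ℝ => c) (𝓝[≠] 0) (𝓝 0) := by
    refine key.congr' ?_
    filter_upwards [hne] with t ht
    field_simp
    ring
  exact tendsto_nhds_unique tendsto_const_nhds h1

/-- A second order expansion of a function of class `C²` is its Taylor expansion. -/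
theorem eq_of_expansion_two {f : E → ℝ} {x₀ : E} (hf : ContDiffAt ℝ 2 f x₀) {a : ℝ}
    {p : E →L[ℝ] ℝ} {q : E → ℝ} (hq : ∀ (t : ℝ) ξ, q (t • ξ) = t ^ 2 * q ξ)
    (h : (fun x => f x - a - p (x - x₀) - (1 / 2) * q (x - x₀)) =o[𝓝 x₀] fun x => ‖x - x₀‖ ^ 2) :
    f x₀ = a ∧ fderiv ℝ f x₀ = p ∧ ∀ ξ, fderiv ℝ (fderiv ℝ f) x₀ ξ ξ = q ξ := by
  have key : ∀ ξ, f x₀ - a = 0 ∧ fderiv ℝ f x₀ ξ - p ξ = 0 ∧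
      (1 / 2) * (fderiv ℝ (fderiv ℝ f) x₀ ξ ξ - q ξ) = 0 := by
    intro ξ
    -- On each line through `x₀` the two expansions differ by a quadratic polynomial in `t` that is
    -- `o(t²)`.
    apply quadratic_coeff_eq_zero
    refine (isLittleO_comp_line (h.sub (taylor_two_isLittleO hf)) ξ).congr_left fun t => ?_
    simp only [add_sub_cancel_left, hq, map_smul, smul_eq_mul, smul_apply]
    ring
  refine ⟨by linarith [(key 0).1], ?_, fun ξ => by linarith [(key ξ).2.2]⟩
  ext ξ
  linarith [(key ξ).2.1]

/-- A first order expansion of a differentiable function. -/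
theorem eq_of_expansion_one {F : Type*} [NormedAddCommGroup F] [NormedSpace ℝ F] {f : E → F}
    {f' : E →L[ℝ] F} {x₀ : E} (hf : HasFDerivAt f f' x₀)
    (h : f =o[𝓝 x₀] fun x => ‖x - x₀‖) : f x₀ = 0 ∧ f' = 0 := by
  have h0 : f x₀ = 0 := by
    have h1 : Tendsto f (𝓝 x₀) (𝓝 0) := by
      refine h.trans_tendsto ?_
      have : Continuous fun x => ‖x - x₀‖ := by fun_prop
      simpa using this.tendsto x₀
    exact tendsto_nhds_unique hf.continuousAt h1
  refine ⟨h0, ?_⟩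
  have h2 : HasFDerivAt f (0 : E →L[ℝ] F) x₀ := by
    refine HasFDerivAt.of_isLittleO ?_
    simpa [h0] using h.of_norm_right
  exact hf.unique h2

theorem eq_of_diag_eq {B C : E →L[ℝ] E →L[ℝ] ℝ} (hB : ∀ v w, B v w = B w v)
    (hC : ∀ v w, C v w = C w v) (h : ∀ v, B v v = C v v) : B = C := by
  ext v w
  have h1 := h (v + w)
  simp only [map_add, add_apply] at h1
  have h2 := h v
  have h3 := h w
  have h4 := hB w v
  have h5 := hC w v
  linarith

theorem symm_fderiv_fderiv {f : E → ℝ} {x₀ : E} (hf : ContDiffAt ℝ 2 f x₀) (v w : E) :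
    fderiv ℝ (fderiv ℝ f) x₀ v w = fderiv ℝ (fderiv ℝ f) x₀ w v :=
  hf.isSymmSndFDerivAt (by simp) v w

end Taylor

/-! ### Jets of functions and their Taylor coefficients. -/

section Jets

theorem two_le_infty : (2 : WithTop ℕ∞) ≤ ∞ := WithTop.coe_le_coe.2 le_top

variable {n : ℕ}

theorem sameJet_one_iff {f g : EX n → ℝ} {x : EX n} :
    SameJet 1 f g x ↔ f x = g x ∧ fderiv ℝ f x = fderiv ℝ g x := by
  constructor
  · intro h
    refine ⟨?_, ?_⟩
    · simpa using congrArg (fun m => m ![]) (h 0 (by norm_num))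
    · ext v
      simpa [iteratedFDeriv_one_apply] using congrArg (fun m => m ![v]) (h 1 (by norm_num))
  · rintro ⟨h0, h1⟩ k hk
    interval_cases k
    · ext m
      simpa using h0
    · ext m
      simp [iteratedFDeriv_one_apply, h1]

theorem sameJet_two_iff {f g : EX n → ℝ} {x : EX n} :
    SameJet 2 f g x ↔ f x = g x ∧ fderiv ℝ f x = fderiv ℝ g x ∧
      fderiv ℝ (fderiv ℝ f) x = fderiv ℝ (fderiv ℝ g) x := by
  constructor
  · intro h
    have h1 := sameJet_one_iff.1 fun k hk => h k (hk.trans one_le_two)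
    refine ⟨h1.1, h1.2, ?_⟩
    ext v w
    simpa [iteratedFDeriv_two_apply] using congrArg (fun m => m ![v, w]) (h 2 le_rfl)
  · rintro ⟨h0, h1, h2⟩ k hk
    rcases Nat.lt_or_eq_of_le hk with hk | rfl
    · exact sameJet_one_iff.2 ⟨h0, h1⟩ k (by omega)
    · ext m
      simp [iteratedFDeriv_two_apply, h2]

/-- The Taylor expansion of `g` is also an order two expansion of `f`, so uniqueness of expansions
followed by polarisation applies. -/
theorem sameJet_of_isLittleO_two {f g : EX n → ℝ} {x₀ : EX n} (hf : ContDiffAt ℝ ∞ f x₀)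
    (hg : ContDiffAt ℝ ∞ g x₀) (h : (fun x => f x - g x) =o[𝓝 x₀] fun x => ‖x - x₀‖ ^ 2) :
    f x₀ = g x₀ ∧ fderiv ℝ f x₀ = fderiv ℝ g x₀ ∧
      fderiv ℝ (fderiv ℝ f) x₀ = fderiv ℝ (fderiv ℝ g) x₀ := by
  have hf2 : ContDiffAt ℝ 2 f x₀ := hf.of_le two_le_infty
  have hg2 : ContDiffAt ℝ 2 g x₀ := hg.of_le two_le_infty
  have key := eq_of_expansion_two hf2 (a := g x₀) (p := fderiv ℝ g x₀)
    (q := fun ξ => fderiv ℝ (fderiv ℝ g) x₀ ξ ξ)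
    (fun t ξ => by simp; ring)
    ((h.add (taylor_two_isLittleO hg2)).congr_left fun x => by ring)
  exact ⟨key.1, key.2.1,
    eq_of_diag_eq (symm_fderiv_fderiv hf2) (symm_fderiv_fderiv hg2) key.2.2⟩

theorem isLittleO_of_sameJet_one {f g : EX n → ℝ} {x₀ : EX n} (hf : ContDiffAt ℝ ∞ f x₀)
    (hg : ContDiffAt ℝ ∞ g x₀) (h : SameJet 1 f g x₀) :
    (fun x => f x - g x) =o[𝓝 x₀] fun x => ‖x - x₀‖ ^ 1 := by
  obtain ⟨h0, h1⟩ := sameJet_one_iff.1 h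
  have hf1 := (hf.differentiableAt (by simp)).hasFDerivAt.isLittleO
  have hg1 := (hg.differentiableAt (by simp)).hasFDerivAt.isLittleO
  simp only [pow_one]
  refine ((hf1.sub hg1).norm_right).congr_left fun x => ?_
  rw [h0, h1]
  ring

theorem isLittleO_of_sameJet_two {f g : EX n → ℝ} {x₀ : EX n} (hf : ContDiffAt ℝ ∞ f x₀)
    (hg : ContDiffAt ℝ ∞ g x₀) (h : SameJet 2 f g x₀) :
    (fun x => f x - g x) =o[𝓝 x₀] fun x => ‖x - x₀‖ ^ 2 := by
  obtain ⟨h0, h1, h2⟩ := sameJet_two_iff.1 h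
  have hf2 := taylor_two_isLittleO (hf.of_le two_le_infty : ContDiffAt ℝ 2 f x₀)
  have hg2 := taylor_two_isLittleO (hg.of_le two_le_infty : ContDiffAt ℝ 2 g x₀)
  refine (hf2.sub hg2).congr_left fun x => ?_
  rw [h0, h1, h2]
  ring

end Jets

/-! ### Contact of subsets of the sphere in the stereographic chart -/

variable {n : ℕ}

/-- Near the point of stereographic coordinates `z₀`, the points of `S` are at distance
`o(‖z - z₀‖ ^ l)` from `T`. -/
def Contact (l : ℕ) (S T : Set (Sph n)) (z₀ : ℝ × EX n) : Prop :=
  ∀ ε > 0, ∀ᶠ z in 𝓝 z₀, stereoInv z ∈ S →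
    ∃ w, stereoInv w ∈ T ∧ ‖w - z‖ ≤ ε * ‖z - z₀‖ ^ l

theorem Contact.refl (l : ℕ) (S : Set (Sph n)) (z₀ : ℝ × EX n) : Contact l S S z₀ :=
  fun ε hε => Eventually.of_forall fun z hz => ⟨z, hz, by simp; positivity⟩

/-- Transitivity is the reason for working with contact: `JetRel` lets the chart depend on the pair
of hypersurfaces and is not visibly transitive. -/
theorem Contact.trans {l : ℕ} (hl : 1 ≤ l) {S T U : Set (Sph n)} {z₀ : ℝ × EX n}
    (h₁ : Contact l S T z₀) (h₂ : Contact l T U z₀) : Contact l S U z₀ := by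
  intro ε hε
  -- The factor `2 ^ l` pays for `‖w - z₀‖ ≤ 2 ‖z - z₀‖` at the intermediate point `w`. That bound
  -- comes from `1 ≤ l` and from capping the first constant at `1`.
  obtain ⟨δ, hδ, hT⟩ := Metric.eventually_nhds_iff_ball.1 (h₂ (ε / 2 / 2 ^ l) (by positivity))
  have hmin : 0 < min (ε / 2) 1 := by positivity
  filter_upwards [h₁ _ hmin, Metric.ball_mem_nhds z₀ (show 0 < min 1 (δ / 2) by positivity)]
    with z hz hball hzS
  obtain ⟨w, hwT, hw⟩ := hz hzS
  have hz1 : ‖z - z₀‖ < min 1 (δ / 2) := by simpa [dist_eq_norm] using hball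
  have hz2 : ‖z - z₀‖ ≤ 1 := (hz1.le.trans (min_le_left _ _))
  have hz3 : ‖z - z₀‖ < δ / 2 := lt_of_lt_of_le hz1 (min_le_right _ _)
  have hpow : ‖z - z₀‖ ^ l ≤ ‖z - z₀‖ :=
    pow_le_of_le_one (norm_nonneg _) hz2 (by omega)
  have hpow0 : 0 ≤ ‖z - z₀‖ ^ l := by positivity
  have hwz : ‖w - z‖ ≤ ‖z - z₀‖ := by
    refine hw.trans ((mul_le_of_le_one_left hpow0 (min_le_right _ _)).trans hpow)
  have hww : ‖w - z₀‖ ≤ 2 * ‖z - z₀‖ := by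
    have := norm_add_le (w - z) (z - z₀)
    rw [sub_add_sub_cancel] at this
    linarith
  obtain ⟨v, hvU, hv⟩ := hT w (by rw [Metric.mem_ball, dist_eq_norm]; linarith) hwT
  refine ⟨v, hvU, ?_⟩
  have h3 : ‖w - z₀‖ ^ l ≤ 2 ^ l * ‖z - z₀‖ ^ l := by
    rw [← mul_pow]
    exact pow_le_pow_left₀ (norm_nonneg _) hww l
  have h4 : ‖v - w‖ ≤ ε / 2 * ‖z - z₀‖ ^ l := by
    refine hv.trans ?_
    calc ε / 2 / 2 ^ l * ‖w - z₀‖ ^ l ≤ ε / 2 / 2 ^ l * (2 ^ l * ‖z - z₀‖ ^ l) := by gcongr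
      _ = ε / 2 * ‖z - z₀‖ ^ l := by field_simp
  have h5 : ‖w - z‖ ≤ ε / 2 * ‖z - z₀‖ ^ l :=
    hw.trans (mul_le_mul_of_nonneg_right (min_le_left _ _) hpow0)
  have := norm_add_le (v - w) (w - z)
  rw [sub_add_sub_cancel] at this
  linarith

theorem continuous_stereoInv : Continuous (stereoInv : ℝ × EX n → Sph n) :=
  contMDiff_stereoInv.continuous

theorem contDiffAt_chart_stereoInv {φ : OpenPartialHomeomorph (Sph n) (ℝ × EX n)}
    (hφ : IsSmoothChart φ) {z : ℝ × EX n} (hz : stereoInv z ∈ φ.source) :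
    ContDiffAt ℝ ∞ (fun z => φ (stereoInv z)) z := by
  have h := (hφ.smooth.contMDiffAt (φ.open_source.mem_nhds hz)).comp z
    contMDiff_stereoInv.contMDiffAt
  exact h.contDiffAt

theorem contDiffAt_stereoFun_chart {φ : OpenPartialHomeomorph (Sph n) (ℝ × EX n)}
    (hφ : IsSmoothChart φ) {v : ℝ × EX n} (hv : v ∈ φ.target)
    (hs : φ.symm v ∈ (stereo n).source) :
    ContDiffAt ℝ ∞ (fun v => stereoFun (φ.symm v)) v := by
  have h := (contMDiffOn_stereoFun.contMDiffAt ((stereo n).open_source.mem_nhds hs)).comp v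
    (hφ.smooth_symm.contMDiffAt (φ.open_target.mem_nhds hv))
  exact h.contDiffAt

/-- A point of `S` is `(f X, X)` in the chart `φ`; its partner on `T` is `(g X, X)`. The transition
from `φ` to the stereographic chart is Lipschitz near `φ p`, so their distance is `O(|f X - g X|)`,
and `X - (φ p).2` is `O(z - z₀)`. -/
theorem contact_of_isGraphAt {l : ℕ} {S T : Set (Sph n)} {p : Sph n}
    (hp : p ∈ (stereo n).source) (hpS : p ∈ S) (hpT : p ∈ T)
    {φ : OpenPartialHomeomorph (Sph n) (ℝ × EX n)} (hφ : IsSmoothChart φ) (hpφ : p ∈ φ.source)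
    {f g : EX n → ℝ} (hf : IsGraphAt φ S p f) (hg : IsGraphAt φ T p g)
    (hfg : (fun x => f x - g x) =o[𝓝 (φ p).2] fun x => ‖x - (φ p).2‖ ^ l) :
    Contact l S T (stereoFun p) := by
  set z₀ := stereoFun p with hz₀
  have hpz : stereoInv z₀ = p := stereoInv_stereoFun hp
  set x₀ := (φ p).2 with hx₀
  have hfx₀ : φ p = (f x₀, x₀) := Prod.ext (hf.2.self_of_nhds.1 hpS) rfl
  have hgx₀ : φ p = (g x₀, x₀) := Prod.ext (hg.2.self_of_nhds.1 hpT) rfl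
  have hinv : Tendsto stereoInv (𝓝 z₀) (𝓝 p) := by
    have := (continuous_stereoInv (n := n)).tendsto z₀
    rwa [hpz] at this
  have hΘ' : ContDiffAt ℝ ∞ (fun z => φ (stereoInv z)) z₀ :=
    contDiffAt_chart_stereoInv hφ (by rwa [hpz])
  have hΘ : ContDiffAt ℝ ∞ (fun v => stereoFun (φ.symm v)) (φ p) :=
    contDiffAt_stereoFun_chart hφ (φ.map_source hpφ) (by rwa [φ.left_inv hpφ])
  obtain ⟨K, s, hs, hK⟩ := (hΘ.of_le (by simp : (1 : WithTop ℕ∞) ≤ ∞)).exists_lipschitzOnWith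
  have hX : Tendsto (fun z => (φ (stereoInv z)).2) (𝓝 z₀) (𝓝 x₀) := by
    have := hΘ'.continuousAt.snd.tendsto
    rwa [hpz] at this
  have hfc : Tendsto (fun x => (f x, x)) (𝓝 x₀) (𝓝 (φ p)) := by
    rw [hfx₀]
    exact hf.1.self_of_nhds.continuousAt.prodMk_nhds continuousAt_id
  have hgc : Tendsto (fun x => (g x, x)) (𝓝 x₀) (𝓝 (φ p)) := by
    rw [hgx₀]
    exact hg.1.self_of_nhds.continuousAt.prodMk_nhds continuousAt_id
  have hsymm : Tendsto φ.symm (𝓝 (φ p)) (𝓝 p) := by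
    have := (φ.continuousAt_symm (φ.map_source hpφ)).tendsto
    rwa [φ.left_inv hpφ] at this
  have hXO : (fun z => (φ (stereoInv z)).2 - x₀) =O[𝓝 z₀] fun z => z - z₀ := by
    have h1 := (hΘ'.differentiableAt (by simp)).isBigO_sub
    rw [hpz] at h1
    exact (Asymptotics.isBigO_of_le _ fun z => norm_snd_le (φ (stereoInv z) - φ p)).trans h1
  have hmain : (fun z => f (φ (stereoInv z)).2 - g (φ (stereoInv z)).2)
      =o[𝓝 z₀] fun z => ‖z - z₀‖ ^ l :=
    (hfg.comp_tendsto hX).trans_isBigO ((hXO.norm_norm).pow l)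
  have hmain2 : (fun z => (K : ℝ) * (f (φ (stereoInv z)).2 - g (φ (stereoInv z)).2))
      =o[𝓝 z₀] fun z => ‖z - z₀‖ ^ l := hmain.const_mul_left _
  intro ε hε
  filter_upwards [hmain2.bound hε, hinv.eventually hf.2, hinv (φ.open_source.mem_nhds hpφ),
    hinv ((stereo n).open_source.mem_nhds hp),
    (hfc.comp hX) hs, (hgc.comp hX) hs, (hgc.comp hX) (φ.open_target.mem_nhds (φ.map_source hpφ)),
    (hsymm.comp (hgc.comp hX)).eventually hg.2,
    (hsymm.comp (hgc.comp hX)) ((stereo n).open_source.mem_nhds hp)]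
    with z hb hzS hzφ hzs hfs hgs hgt hgT hgst hz
  set y := stereoInv z with hy
  have hy1 : φ y = (f (φ y).2, (φ y).2) := Prod.ext (hzS.1 hz) rfl
  refine ⟨stereoFun (φ.symm (g (φ y).2, (φ y).2)), ?_, ?_⟩
  · have : stereoInv (stereoFun (φ.symm (g (φ y).2, (φ y).2))) = φ.symm (g (φ y).2, (φ y).2) :=
      stereoInv_stereoFun hgst
    rw [this]
    refine hgT.2 ?_
    have hr : φ (φ.symm (g (φ y).2, (φ y).2)) = (g (φ y).2, (φ y).2) := φ.right_inv hgt
    simp only [Function.comp_apply, ← hy]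
    rw [hr]
  · have hzz : z = stereoFun (φ.symm (f (φ y).2, (φ y).2)) := by
      rw [← hy1, φ.left_inv hzφ]
      exact (stereoFun_stereoInv z).symm
    have h2 := hK.norm_sub_le hgs hfs
    simp only [Function.comp_apply, ← hy] at h2
    rw [← hzz] at h2
    refine h2.trans ?_
    have h3 : ‖((g (φ y).2, (φ y).2) : ℝ × EX n) - (f (φ y).2, (φ y).2)‖
        = ‖f (φ y).2 - g (φ y).2‖ := by
      simp [Prod.norm_def, abs_sub_comm]
    rw [h3]
    simpa using hb

theorem JetRel.symm {l : ℕ} {S T : Hyp n} (h : JetRel l S T) : JetRel l T S := by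
  obtain ⟨hp, φ, hφ, hm, f, g, hf, hg, hj⟩ := h
  rw [hp] at hm hf hg hj
  exact ⟨hp.symm, φ, hφ, hm, g, f, hg, hf, fun k hk => (hj k hk).symm⟩

theorem JetRel.contact {l : ℕ} (hl : l = 1 ∨ l = 2) {S T : Hyp n} (h : JetRel l S T)
    (hp : S.pt ∈ (stereo n).source) : Contact l S.carrier T.carrier (stereoFun S.pt) := by
  obtain ⟨hpt, φ, hφ, hm, f, g, hf, hg, hj⟩ := h
  refine contact_of_isGraphAt hp S.mem (hpt ▸ T.mem) hφ hm hf hg ?_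
  rcases hl with rfl | rfl
  · exact isLittleO_of_sameJet_one hf.1.self_of_nhds hg.1.self_of_nhds hj
  · exact isLittleO_of_sameJet_two hf.1.self_of_nhds hg.1.self_of_nhds hj

/-- Hypersurfaces with the same jet have the same point and are in contact. -/
theorem contact_of_jet_eq {l : ℕ} (hl : l = 1 ∨ l = 2) {S T : Hyp n} (h : jet l S = jet l T) :
    S.pt = T.pt ∧ (S.pt ∈ (stereo n).source →
      Contact l S.carrier T.carrier (stereoFun S.pt) ∧
        Contact l T.carrier S.carrier (stereoFun S.pt)) := by
  have h1 : 1 ≤ l := by omega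
  have h' := Quot.eqvGen_exact h
  clear h
  -- Equality in the quotient only yields the generated equivalence relation. Both directions of
  -- contact are carried along because the symmetric case exchanges them.
  induction h' with
  | rel S T h =>
    refine ⟨h.1, fun hp => ⟨h.contact hl hp, ?_⟩⟩
    have := h.symm.contact hl (h.1 ▸ hp)
    rwa [← h.1] at this
  | refl S => exact ⟨rfl, fun _ => ⟨Contact.refl _ _ _, Contact.refl _ _ _⟩⟩
  | symm S T h ih =>
    refine ⟨ih.1.symm, fun hp => ?_⟩
    have := ih.2 (ih.1 ▸ hp)
    rw [ih.1] at this
    exact this.symm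
  | trans S T U h h' ih ih' =>
    refine ⟨ih.1.trans ih'.1, fun hp => ?_⟩
    have h2 := ih.2 hp
    have h3 := ih'.2 (ih.1 ▸ hp)
    rw [← ih.1] at h3
    exact ⟨h2.1.trans h1 h3.1, h3.2.trans h1 h2.2⟩

theorem IsGraphAt.eventually_stereoInv {S : Set (Sph n)} {p : Sph n} {f : EX n → ℝ}
    (h : IsGraphAt (stereo n) S p f) (hp : p ∈ (stereo n).source) :
    ∀ᶠ z in 𝓝 (stereoFun p), stereoInv z ∈ S ↔ z.1 = f z.2 := by
  have hinv : Tendsto stereoInv (𝓝 (stereoFun p)) (𝓝 p) := by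
    have := (continuous_stereoInv (n := n)).tendsto (stereoFun p)
    rwa [stereoInv_stereoFun hp] at this
  filter_upwards [hinv.eventually h.2] with z hz
  rw [hz]
  have : stereo n (stereoInv z) = z := stereoFun_stereoInv z
  rw [this]

theorem IsGraphAt.apply_pt {S : Set (Sph n)} {p : Sph n} {f : EX n → ℝ}
    (h : IsGraphAt (stereo n) S p f) (hp : p ∈ S) : f (stereoFun p).2 = (stereoFun p).1 :=
  (h.2.self_of_nhds.1 hp).symm

/-- The functions whose graphs in the stereographic chart are in contact have the same jet. -/
theorem isLittleO_of_contact {l : ℕ} (hl : l ≠ 0) {S T : Set (Sph n)} {p : Sph n}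
    (hp : p ∈ (stereo n).source) (hpS : p ∈ S) {f g : EX n → ℝ}
    (hf : IsGraphAt (stereo n) S p f) (hg : IsGraphAt (stereo n) T p g)
    (h : Contact l S T (stereoFun p)) :
    (fun x => f x - g x) =o[𝓝 (stereoFun p).2] fun x => ‖x - (stereoFun p).2‖ ^ l := by
  set z₀ := stereoFun p with hz₀
  have hfz : z₀ = (f z₀.2, z₀.2) := Prod.ext (hf.apply_pt hpS).symm rfl
  have hfd : ContDiffAt ℝ ∞ f z₀.2 := hf.1.self_of_nhds
  have hgd : ContDiffAt ℝ ∞ g z₀.2 := hg.1.self_of_nhds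
  have hfc : Tendsto (fun x => (f x, x)) (𝓝 z₀.2) (𝓝 z₀) := by
    conv_rhs => rw [hfz]
    exact hfd.continuousAt.prodMk_nhds continuousAt_id
  have hzO : (fun x => (f x, x) - z₀) =O[𝓝 z₀.2] fun x => x - z₀.2 := by
    have h1 := ((hfd.prodMk contDiffAt_id).differentiableAt (by simp)).isBigO_sub
    have h2 : (f z₀.2, id z₀.2) = z₀ := hfz.symm
    rw [h2] at h1
    exact h1
  obtain ⟨C, hC, hCb⟩ := ((hzO.norm_norm).pow l).exists_pos
  obtain ⟨K, s, hs, hK⟩ := (hgd.of_le (by simp : (1 : WithTop ℕ∞) ≤ ∞)).exists_lipschitzOnWith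
  have hev : ∀ᶠ w in 𝓝 z₀, (stereoInv w ∈ T ↔ w.1 = g w.2) ∧ w.2 ∈ s :=
    (hg.eventually_stereoInv hp).and (continuous_snd.continuousAt.eventually hs)
  obtain ⟨δ, hδ, hball⟩ := Metric.eventually_nhds_iff_ball.1 hev
  rw [Asymptotics.isLittleO_iff]
  intro c hc
  have hK1 : (0 : ℝ) < 1 + K := by positivity
  have hε : 0 < min 1 (c / (C * (1 + K))) := by positivity
  filter_upwards [hfc.eventually (h _ hε), hfc.eventually (hf.eventually_stereoInv hp), hCb.bound,
    hfc (Metric.ball_mem_nhds z₀ (show 0 < min 1 (δ / 2) by positivity)), hs]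
    with x h1 h2 h3 h4 h5
  obtain ⟨w, hwT, hw⟩ := h1 (h2.2 rfl)
  have hz1 : ‖((f x, x) : ℝ × EX n) - z₀‖ < min 1 (δ / 2) := by
    simpa [dist_eq_norm] using h4
  have hz2 : ‖((f x, x) : ℝ × EX n) - z₀‖ ≤ 1 := hz1.le.trans (min_le_left _ _)
  have hz3 : ‖((f x, x) : ℝ × EX n) - z₀‖ < δ / 2 := lt_of_lt_of_le hz1 (min_le_right _ _)
  have hpow : ‖((f x, x) : ℝ × EX n) - z₀‖ ^ l ≤ ‖((f x, x) : ℝ × EX n) - z₀‖ :=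
    pow_le_of_le_one (norm_nonneg _) hz2 hl
  have hwz : ‖w - (f x, x)‖ ≤ ‖((f x, x) : ℝ × EX n) - z₀‖ :=
    hw.trans ((mul_le_of_le_one_left (by positivity) (min_le_left _ _)).trans hpow)
  have hww : w ∈ Metric.ball z₀ δ := by
    have := norm_add_le (w - (f x, x)) ((f x, x) - z₀)
    rw [sub_add_sub_cancel] at this
    rw [Metric.mem_ball, dist_eq_norm]
    linarith
  obtain ⟨hw1, hw2⟩ := hball w hww
  have hw3 := hw1.1 hwT
  have h6 : |f x - w.1| ≤ ‖w - (f x, x)‖ := by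
    rw [abs_sub_comm]
    exact norm_fst_le (w - (f x, x))
  have h7 : |g w.2 - g x| ≤ K * ‖w - (f x, x)‖ := by
    refine (hK.norm_sub_le hw2 h5).trans ?_
    gcongr
    exact norm_snd_le (w - (f x, x))
  -- The nearby point `w` of `T` need not lie over `x`; the Lipschitz constant of `g` pays for
  -- moving its base point back to `x`.
  have h8 : |f x - g x| ≤ (1 + K) * ‖w - (f x, x)‖ := by
    have : f x - g x = (f x - w.1) + (g w.2 - g x) := by rw [hw3]; ring
    rw [this]
    refine (abs_add_le _ _).trans ?_
    linarith
  have h9 : ‖w - (f x, x)‖ ≤ c / (C * (1 + K)) * (C * ‖x - z₀.2‖ ^ l) := by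
    refine hw.trans ?_
    have h3' : ‖((f x, x) : ℝ × EX n) - z₀‖ ^ l ≤ C * ‖x - z₀.2‖ ^ l := by simpa using h3
    exact mul_le_mul (min_le_right _ _) h3' (by positivity) (by positivity)
  rw [Real.norm_eq_abs]
  calc |f x - g x| ≤ (1 + K) * (c / (C * (1 + K)) * (C * ‖x - z₀.2‖ ^ l)) :=
        h8.trans (by gcongr)
    _ = c * ‖‖x - z₀.2‖ ^ l‖ := by
        rw [norm_pow, norm_norm]
        field_simp

/-- The matrix of the second derivatives of a function. -/
def hess (f : EX n → ℝ) (x : EX n) : Matrix (Fin n) (Fin n) ℝ := fun i k =>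
  fderiv ℝ (fderiv ℝ f) x (EuclideanSpace.single i 1) (EuclideanSpace.single k 1)

/-- The vector of the first derivatives of a function. -/
def grad (f : EX n → ℝ) (x : EX n) : Fin n → ℝ := fun i =>
  fderiv ℝ f x (EuclideanSpace.single i 1)

theorem hasCoords_iff {j : Jet 2 n} {u : ℝ} {x : EX n} {p : Fin n → ℝ}
    {U : Matrix (Fin n) (Fin n) ℝ} : HasCoords j u x p U ↔
      ∃ (S : Hyp n) (f : EX n → ℝ), j = jet 2 S ∧ S.pt ∈ (stereo n).source ∧
        stereoFun S.pt = (u, x) ∧ IsGraphAt (stereo n) S.carrier S.pt f ∧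
        p = grad f x ∧ U = hess f x := by
  unfold HasCoords
  have hU : ∀ f : EX n → ℝ, (∀ i k, U i k = fderiv ℝ (fderiv ℝ f) x
      (EuclideanSpace.single i 1) (EuclideanSpace.single k 1)) ↔ U = hess f x :=
    fun f => Matrix.ext_iff (N := hess f x)
  simp only [iteratedFDeriv_two_apply, grad, funext_iff, ← hU]
  rfl

/-- Two representatives of a jet may be linked only by a chain of `JetRel` in various charts.
Contact survives the chain and forces their stereographic graphs to agree to order two. -/
theorem HasCoords.unique {j : Jet 2 n} {u u' : ℝ} {x x' : EX n} {p p' : Fin n → ℝ}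
    {U U' : Matrix (Fin n) (Fin n) ℝ} (h : HasCoords j u x p U) (h' : HasCoords j u' x' p' U') :
    u = u' ∧ x = x' ∧ p = p' ∧ U = U' := by
  obtain ⟨S, f, hj, hS, hz, hf, rfl, rfl⟩ := hasCoords_iff.1 h
  obtain ⟨T, g, hj', hT, hz', hg, rfl, rfl⟩ := hasCoords_iff.1 h'
  obtain ⟨hpt, hc⟩ := contact_of_jet_eq (Or.inr rfl) (hj.symm.trans hj')
  rw [← hpt] at hz' hg hT
  have hxx : (u, x) = (u', x') := hz.symm.trans hz'
  simp only [Prod.mk.injEq] at hxx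
  obtain ⟨rfl, rfl⟩ := hxx
  have hlo := isLittleO_of_contact two_ne_zero hS S.mem hf hg (hc hS).1
  have h1 := hf.1.self_of_nhds
  have h2 := hg.1.self_of_nhds
  change ContDiffAt ℝ ∞ f (stereoFun S.pt).2 at h1
  change ContDiffAt ℝ ∞ g (stereoFun S.pt).2 at h2
  rw [hz] at hlo h1 h2
  obtain ⟨-, h3, h4⟩ := sameJet_of_isLittleO_two h1 h2 hlo
  exact ⟨rfl, rfl, by unfold grad; rw [h3], by unfold hess; rw [h4]⟩

/-! ### The Lorentzian form and the light cone in stereographic coordinates -/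

section Lorentz

variable {n : ℕ}

theorem cu_add (v w : V n) : cu (v + w) = cu v + cu w := rfl
theorem cx_add (v w : V n) : cx (v + w) = cx v + cx w := rfl
theorem ct_add (v w : V n) : ct (v + w) = ct v + ct w := rfl
theorem cu_smul (c : ℝ) (v : V n) : cu (c • v) = c * cu v := rfl
theorem cx_smul (c : ℝ) (v : V n) : cx (c • v) = c • cx v := rfl
theorem ct_smul (c : ℝ) (v : V n) : ct (c • v) = c * ct v := rfl

/-- The coordinate `u` on `W`. -/
def wu : W n →L[ℝ] ℝ := LinearMap.toContinuousLinearMap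
  { toFun := fun w => cu w.2
    map_add' := fun _ _ => rfl
    map_smul' := fun _ _ => rfl }

/-- The coordinates `x` on `W`. -/
def wx : W n →L[ℝ] EX n := LinearMap.toContinuousLinearMap
  { toFun := fun w => cx w.2
    map_add' := fun _ _ => rfl
    map_smul' := fun _ _ => rfl }

/-- The null coordinate `lam + t` on `W`. -/
def wd : W n →L[ℝ] ℝ := LinearMap.toContinuousLinearMap
  { toFun := fun w => w.1 + ct w.2
    map_add' := fun v w => by simp [ct_add]; ring
    map_smul' := fun c w => by simp [ct_smul]; ring }

theorem wu_apply (w : W n) : wu w = cu w.2 := rfl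
theorem wx_apply (w : W n) : wx w = cx w.2 := rfl
theorem wd_apply (w : W n) : wd w = w.1 + ct w.2 := rfl

theorem ext_W {v w : W n} (h : v.1 = w.1) (hu : cu v.2 = cu w.2) (hx : cx v.2 = cx w.2)
    (ht : ct v.2 = ct w.2) : v = w := by
  refine Prod.ext h ?_
  rw [← mkV_eta v.2, ← mkV_eta w.2, hu, hx, ht]

theorem lorentz_eq (w : W n) :
    lorentz w = -w.1 ^ 2 + (cu w.2 ^ 2 + ‖cx w.2‖ ^ 2 + ct w.2 ^ 2) := by
  rw [lorentz, ← normSq_mkV, mkV_eta]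

/-- The bilinear form polar to the Lorentzian quadratic form. -/
def lor (v w : W n) : ℝ := (lorentz (v + w) - lorentz v - lorentz w) / 2

theorem lor_eq (v w : W n) : lor v w =
    -(v.1 * w.1) + cu v.2 * cu w.2 + inner ℝ (cx v.2) (cx w.2) + ct v.2 * ct w.2 := by
  simp only [lor, lorentz_eq, Prod.fst_add, Prod.snd_add, cu_add, cx_add, ct_add,
    norm_add_sq_real]
  ring

theorem lor_map {A : W n ≃ₗ[ℝ] W n} (hA : ∀ w, lorentz (A w) = lorentz w) (v w : W n) :
    lor (A v) (A w) = lor v w := by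
  rw [lor, ← map_add, hA, hA, hA, lor]

/-- The null vector over the point of stereographic coordinates `z`. -/
def cone (z : ℝ × EX n) : W n :=
  (4 + (z.1 ^ 2 + ‖z.2‖ ^ 2), mkV (4 * z.1) ((4 : ℝ) • z.2) (4 - (z.1 ^ 2 + ‖z.2‖ ^ 2)))

/-- The derivative of `cone` at `z` in the direction `τ`. -/
def dcone (z τ : ℝ × EX n) : W n :=
  (2 * (z.1 * τ.1 + inner ℝ z.2 τ.2),
    mkV (4 * τ.1) ((4 : ℝ) • τ.2) (-(2 * (z.1 * τ.1 + inner ℝ z.2 τ.2))))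

/-- The null vector `(1, 0, 0, -1)` over the centre of the stereographic projection. -/
def eminus : W n := (1, mkV 0 0 (-1))

/-- The null vector `(1, 0, 0, 1)` over the origin. -/
def eplus : W n := (1, mkV 0 0 1)

/-- This Taylor formula is exact, and its quadratic term has the fixed direction `eminus`. That term
is the source of the multiple of the identity in the transformation law of second derivatives. -/
theorem cone_add (z τ : ℝ × EX n) :
    cone (z + τ) = cone z + dcone z τ + (τ.1 ^ 2 + ‖τ.2‖ ^ 2) • eminus := by
  refine ext_W ?_ ?_ ?_ ?_
  · simp [cone, dcone, eminus, norm_add_sq_real]; ring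
  · simp [cone, dcone, eminus, cu_add, cu_smul]; ring
  · simp [cone, dcone, eminus, cx_add, cx_smul]
  · simp [cone, dcone, eminus, ct_add, ct_smul, norm_add_sq_real]; ring

/-- `dcone z` as a linear map. -/
def dconeL (z : ℝ × EX n) : ℝ × EX n →L[ℝ] W n := LinearMap.toContinuousLinearMap
  { toFun := dcone z
    map_add' := fun τ σ => by
      refine ext_W ?_ ?_ ?_ ?_
      · simp [dcone, inner_add_right]; ring
      · simp [dcone, cu_add]; ring
      · simp [dcone, cx_add]
      · simp [dcone, ct_add, inner_add_right]; ring
    map_smul' := fun c τ => by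
      refine ext_W ?_ ?_ ?_ ?_
      · simp [dcone, inner_smul_right]; ring
      · simp [dcone, cu_smul]; ring
      · simp [dcone, cx_smul, smul_comm c]
      · simp [dcone, ct_smul, inner_smul_right]; ring }

theorem dconeL_apply (z τ : ℝ × EX n) : dconeL z τ = dcone z τ := rfl

theorem lift_stereoInv (z : ℝ × EX n) :
    lift (stereoInv z) = (4 + (z.1 ^ 2 + ‖z.2‖ ^ 2))⁻¹ • cone z := by
  refine Prod.ext ?_ rfl
  exact (inv_mul_cancel₀ (stereo_den_pos z).ne').symm

/-- This is the conformality of the stereographic chart: the pairing is a multiple of the Euclidean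
one, independent of `z`. -/
theorem lor_dcone_dcone (z τ σ : ℝ × EX n) :
    lor (dcone z τ) (dcone z σ) = 16 * (τ.1 * σ.1 + inner ℝ τ.2 σ.2) := by
  simp [lor_eq, dcone, inner_smul_left, inner_smul_right]
  ring

theorem lor_dcone_cone (z τ : ℝ × EX n) : lor (dcone z τ) (cone z) = 0 := by
  simp [lor_eq, dcone, cone, inner_smul_left, inner_smul_right, real_inner_comm z.2 τ.2]
  ring

theorem lor_cone_eminus (z : ℝ × EX n) : lor (cone z) eminus = -8 := by
  simp [lor_eq, cone, eminus]
  ring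

theorem lor_eplus (w : W n) : lor w eplus = ct w.2 - w.1 := by
  simp [lor_eq, eplus]
  ring

theorem lor_add_right (v w w' : W n) : lor v (w + w') = lor v w + lor v w' := by
  simp [lor_eq, cu_add, cx_add, ct_add, inner_add_right]
  ring

theorem lor_smul_right (c : ℝ) (v w : W n) : lor v (c • w) = c * lor v w := by
  simp [lor_eq, cu_smul, cx_smul, ct_smul, inner_smul_right]
  ring

theorem lor_comm (v w : W n) : lor v w = lor w v := by
  rw [lor, lor, add_comm v w]
  ring

/-- The vectors `cone z`, `dcone z τ` and `eminus` span `W`. -/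
theorem exists_decomposition (z : ℝ × EX n) (w : W n) :
    ∃ (α β : ℝ) (τ : ℝ × EX n), w = α • cone z + dcone z τ + β • eminus := by
  -- The null coordinate `lam + t` vanishes on `dcone z τ` and on `eminus`, and equals `8` on `cone
  -- z`, so it determines `α`.
  set α := (w.1 + ct w.2) / 8 with hα
  set τ : ℝ × EX n := ((cu w.2 - α * (4 * z.1)) / 4, (4 : ℝ)⁻¹ • (cx w.2 - (α * 4) • z.2)) with hτ
  refine ⟨α, w.1 - α * (4 + (z.1 ^ 2 + ‖z.2‖ ^ 2)) - 2 * (z.1 * τ.1 + inner ℝ z.2 τ.2), τ, ?_⟩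
  refine ext_W ?_ ?_ ?_ ?_
  · simp [cone, dcone, eminus]
  · simp [cone, dcone, eminus, cu_add, cu_smul, hτ]; ring
  · simp [cone, dcone, eminus, cx_add, cx_smul, hτ, smul_smul]
  · simp only [Prod.snd_add, Prod.smul_snd, ct_add, ct_smul, cone, dcone, eminus, ct_mkV]
    have : ct w.2 = 8 * α - w.1 := by rw [hα]; ring
    rw [this]
    ring

theorem hasFDerivAt_cone (z : ℝ × EX n) : HasFDerivAt cone (dconeL z) z := by
  rw [hasFDerivAt_iff_isLittleO_nhds_zero]
  have h : ∀ τ : ℝ × EX n, cone (z + τ) - cone z - dconeL z τ =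
      (τ.1 ^ 2 + ‖τ.2‖ ^ 2) • eminus := by
    intro τ
    rw [cone_add, dconeL_apply]
    abel
  simp_rw [h]
  have h1 : (fun τ : ℝ × EX n => τ.1 ^ 2 + ‖τ.2‖ ^ 2) =O[𝓝 0] fun τ => ‖τ‖ ^ 2 := by
    refine Asymptotics.IsBigO.of_bound 2 (Eventually.of_forall fun τ => ?_)
    have h1 := norm_fst_le τ
    have h2 := norm_snd_le τ
    have h3 : τ.1 ^ 2 ≤ ‖τ‖ ^ 2 := by
      rw [← sq_abs]
      exact pow_le_pow_left₀ (abs_nonneg _) h1 2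
    have h4 : ‖τ.2‖ ^ 2 ≤ ‖τ‖ ^ 2 := pow_le_pow_left₀ (norm_nonneg _) h2 2
    rw [Real.norm_of_nonneg (by positivity), Real.norm_of_nonneg (by positivity)]
    linarith
  have h2 := h1.trans_isLittleO (Asymptotics.isLittleO_norm_pow_id (E' := ℝ × EX n) one_lt_two)
  have h3 : (fun τ : ℝ × EX n => (τ.1 ^ 2 + ‖τ.2‖ ^ 2) • (eminus : W n)) =O[𝓝 0]
      fun τ => τ.1 ^ 2 + ‖τ.2‖ ^ 2 :=
    Asymptotics.IsBigO.of_bound ‖(eminus : W n)‖ (Eventually.of_forall fun τ => by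
      rw [norm_smul, mul_comm])
  exact h3.trans_isLittleO h2

theorem contDiff_cone : ContDiff ℝ ∞ (cone : ℝ × EX n → W n) := by
  have hq : ContDiff ℝ ∞ (fun z : ℝ × EX n => z.1 ^ 2 + ‖z.2‖ ^ 2) :=
    (contDiff_fst.pow 2).add (contDiff_snd.norm_sq ℝ)
  refine (contDiff_const.add hq).prodMk ?_
  exact contDiff_mkV.comp ((contDiff_const.mul contDiff_fst).prodMk
    ((contDiff_snd.const_smul (4 : ℝ)).prodMk (contDiff_const.sub hq)))

/-- The action of `g`, read in the stereographic chart. -/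
theorem stereoFun_actFun (g : SOW n) (z : ℝ × EX n) :
    stereoFun (actFun g (stereoInv z)) =
      ((2 / wd ((g : W n ≃ₗ[ℝ] W n) (cone z))) * wu ((g : W n ≃ₗ[ℝ] W n) (cone z)),
        (2 / wd ((g : W n ≃ₗ[ℝ] W n) (cone z))) • wx ((g : W n ≃ₗ[ℝ] W n) (cone z))) := by
  have hne := map_lift_ne g (stereoInv z)
  have hc := (stereo_den_pos z).ne'
  rw [lift_stereoInv, map_smul, Prod.smul_fst, smul_eq_mul] at hne
  have hc' := inv_ne_zero hc
  have hw : ((g : W n ≃ₗ[ℝ] W n) (cone z)).1 ≠ 0 := right_ne_zero_of_mul hne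
  have hv : (actFun g (stereoInv z) : V n) = (((g : W n ≃ₗ[ℝ] W n) (cone z)).1)⁻¹ •
      ((g : W n ≃ₗ[ℝ] W n) (cone z)).2 := by
    change (((g : W n ≃ₗ[ℝ] W n) (lift (stereoInv z))).1)⁻¹ •
      ((g : W n ≃ₗ[ℝ] W n) (lift (stereoInv z))).2 = _
    rw [lift_stereoInv, map_smul, Prod.smul_fst, Prod.smul_snd, smul_eq_mul, mul_inv, smul_smul]
    congr 1
    field_simp
  rw [stereoFun, hv, cu_smul, cx_smul, ct_smul, wd_apply, wu_apply, wx_apply]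
  set w := (g : W n ≃ₗ[ℝ] W n) (cone z)
  have h1 : 1 + w.1⁻¹ * ct w.2 = (w.1 + ct w.2) * w.1⁻¹ := by field_simp
  have h2 : 2 / (1 + w.1⁻¹ * ct w.2) * w.1⁻¹ = 2 / (w.1 + ct w.2) := by
    rw [h1, div_mul_eq_div_div, div_inv_eq_mul, mul_assoc, mul_inv_cancel₀ hw, mul_one]
  refine Prod.ext ?_ ?_
  · simp only
    rw [← mul_assoc, h2]
  · simp only
    rw [smul_smul, h2]

theorem actFun_mem_source (g : SOW n) (z : ℝ × EX n)
    (h : wd ((g : W n ≃ₗ[ℝ] W n) (cone z)) ≠ 0) :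
    actFun g (stereoInv z) ∈ (stereo n).source := by
  intro hct
  apply h
  have hl := lift_actFun g (stereoInv z)
  rw [lift_stereoInv, map_smul, Prod.smul_fst, smul_eq_mul] at hl
  have h2 := congrArg wd hl
  rw [map_smul, map_smul] at h2
  have h3 : wd (lift (actFun g (stereoInv z))) = 0 := by
    rw [wd_apply]
    change 1 + ct (actFun g (stereoInv z) : V n) = 0
    rw [hct]
    ring
  rw [h3, smul_smul] at h2
  have hne := map_lift_ne g (stereoInv z)
  rw [lift_stereoInv, map_smul, Prod.smul_fst, smul_eq_mul] at hne
  rcases smul_eq_zero.1 h2.symm with h4 | h4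
  · exact absurd h4 (mul_ne_zero (inv_ne_zero hne) (inv_ne_zero (stereo_den_pos z).ne'))
  · exact h4

/-- The value of an element sending the point of coordinates `z` to the origin. -/
theorem map_cone_of_actFun_eq_origin {g : SOW n} {z : ℝ × EX n}
    (h : actFun g (stereoInv z) = origin n) :
    (g : W n ≃ₗ[ℝ] W n) (cone z) = ((g : W n ≃ₗ[ℝ] W n) (cone z)).1 • eplus ∧
      ((g : W n ≃ₗ[ℝ] W n) (cone z)).1 ≠ 0 := by
  have hl := lift_actFun g (stereoInv z)
  have hne := map_lift_ne g (stereoInv z)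
  rw [lift_stereoInv, map_smul, Prod.smul_fst, smul_eq_mul] at hl hne
  have hw : ((g : W n ≃ₗ[ℝ] W n) (cone z)).1 ≠ 0 := right_ne_zero_of_mul hne
  refine ⟨?_, hw⟩
  have he : lift (actFun g (stereoInv z)) = eplus := by rw [h]; rfl
  have hc := (stereo_den_pos z).ne'
  rw [he, smul_smul] at hl
  rw [hl, smul_smul]
  set w := (g : W n ≃ₗ[ℝ] W n) (cone z)
  have : w.1 * (((4 + (z.1 ^ 2 + ‖z.2‖ ^ 2))⁻¹ * w.1)⁻¹ * (4 + (z.1 ^ 2 + ‖z.2‖ ^ 2))⁻¹) = 1 := by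
    field_simp
  rw [this, one_smul]

end Lorentz

/-! ### Images of graphs -/

section Reparametrisation

variable {E : Type*} [NormedAddCommGroup E] [NormedSpace ℝ E]

theorem isLittleO_bilin_sub {F : Type*} [NormedAddCommGroup F] (B : E →L[ℝ] E →L[ℝ] ℝ)
    {a b : F → E} {x₀ : F} (ha : a =O[𝓝 x₀] fun x => x - x₀)
    (hab : (fun x => a x - b x) =o[𝓝 x₀] fun x => x - x₀) :
    (fun x => B (a x) (a x) - B (b x) (b x)) =o[𝓝 x₀] fun x => ‖x - x₀‖ ^ 2 := by
  have hb : b =O[𝓝 x₀] fun x => x - x₀ := by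
    have := ha.sub hab.isBigO
    simpa using this
  have hB : ∀ {c d : F → E}, (c =o[𝓝 x₀] fun x => x - x₀) → (d =O[𝓝 x₀] fun x => x - x₀) →
      ((fun x => B (c x) (d x)) =o[𝓝 x₀] fun x => ‖x - x₀‖ ^ 2) ∧
        (fun x => B (d x) (c x)) =o[𝓝 x₀] fun x => ‖x - x₀‖ ^ 2 := by
    intro c d hc hd
    have h1 : (fun x => ‖c x‖ * ‖d x‖) =o[𝓝 x₀] fun x => ‖x - x₀‖ ^ 2 := by
      simp_rw [pow_two]
      exact hc.norm_norm.mul_isBigO hd.norm_norm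
    refine ⟨Asymptotics.IsBigO.trans_isLittleO (Asymptotics.IsBigO.of_bound ‖B‖
      (Eventually.of_forall fun x => ?_)) h1, Asymptotics.IsBigO.trans_isLittleO
      (Asymptotics.IsBigO.of_bound ‖B‖ (Eventually.of_forall fun x => ?_)) h1⟩
    · refine (B.le_opNorm₂ _ _).trans_eq ?_
      rw [Real.norm_of_nonneg (by positivity), mul_assoc]
    · refine (B.le_opNorm₂ _ _).trans_eq ?_
      rw [Real.norm_of_nonneg (by positivity), mul_assoc, mul_comm ‖d x‖]
  -- The decomposition is `B(a, a) - B(b, b) = B(a - b, a) + B(b, a - b)`.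
  refine ((hB hab ha).1.add (hB hab hb).2).congr_left fun x => ?_
  simp only [map_sub, sub_apply]
  ring

/-- By the inverse function theorem the parametrised set of the `(Y x, X x)` is locally the graph of
`Y ∘ X⁻¹`. Since `Y` has no terms of order zero or one, only the differential `M` of `X` enters the
quadratic term, not its second derivative. -/
theorem exists_reparametrisation [CompleteSpace E] {X : E → E} {Y : E → ℝ} {x₀ : E}
    {M : E ≃L[ℝ] E} {B : E →L[ℝ] E →L[ℝ] ℝ} (hX : ∀ᶠ x in 𝓝 x₀, ContDiffAt ℝ ∞ X x)
    (hY : ∀ᶠ x in 𝓝 x₀, ContDiffAt ℝ ∞ Y x) (hX0 : X x₀ = 0)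
    (hM : HasFDerivAt X (M : E →L[ℝ] E) x₀)
    (hB : (fun x => Y x - (1 / 2) * B (x - x₀) (x - x₀)) =o[𝓝 x₀] fun x => ‖x - x₀‖ ^ 2) :
    ∃ e : OpenPartialHomeomorph E E, x₀ ∈ e.source ∧ (∀ x, e x = X x) ∧
      (∀ᶠ v in 𝓝 0, ContDiffAt ℝ ∞ (fun v => Y (e.symm v)) v) ∧
      (fun v => Y (e.symm v) - (1 / 2) * B (M.symm v) (M.symm v)) =o[𝓝 0] fun v => ‖v‖ ^ 2 := by
  have hX1 := hX.self_of_nhds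
  set e := hX1.toOpenPartialHomeomorph X hM (by simp) with he
  have hs : x₀ ∈ e.source := hX1.mem_toOpenPartialHomeomorph_source hM (by simp)
  have heX : ∀ x, e x = X x := fun x => rfl
  have ht : (0 : E) ∈ e.target := by
    rw [← hX0]
    exact hX1.image_mem_toOpenPartialHomeomorph_target hM (by simp)
  have he0 : e.symm 0 = x₀ := by
    rw [← hX0, ← heX]
    exact e.left_inv hs
  have hsymm : Tendsto e.symm (𝓝 0) (𝓝 x₀) := by
    have := (e.continuousAt_symm ht).tendsto
    rwa [he0] at this
  -- `IsGraphAt` asks for smoothness on a whole neighbourhood. Invertible maps form an open set, so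
  -- the differential of `X` stays invertible near `x₀` and `e.symm` is smooth near `0`.
  have hfd : ∀ᶠ x in 𝓝 x₀, fderiv ℝ X x ∈ Set.range ((↑) : (E ≃L[ℝ] E) → E →L[ℝ] E) := by
    have hc : ContinuousAt (fderiv ℝ X) x₀ :=
      (hX1.fderiv_right (m := 0) (by simp)).continuousAt
    have := hc.tendsto
    rw [hM.fderiv] at this
    exact this (ContinuousLinearEquiv.nhds M)
  have hderiv0 : HasFDerivAt e.symm (M.symm : E →L[ℝ] E) 0 := by
    refine e.hasFDerivAt_symm ht ?_
    rw [he0]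
    exact hM
  refine ⟨e, hs, heX, ?_, ?_⟩
  · filter_upwards [hsymm.eventually hX, hsymm.eventually hY, hsymm.eventually hfd,
      e.open_target.mem_nhds ht] with v h1 h2 h3 h4
    obtain ⟨N, hN⟩ := h3
    have hd : HasFDerivAt e (N : E →L[ℝ] E) (e.symm v) := by
      rw [hN]
      exact (h1.differentiableAt (by simp)).hasFDerivAt
    exact h2.comp v (e.contDiffAt_symm h4 hd h1)
  · have hO : (fun v => e.symm v - x₀) =O[𝓝 0] fun v => v - 0 := by
      have := hderiv0.isBigO_sub
      rwa [he0] at this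
    have h1 : (fun v => Y (e.symm v) - (1 / 2) * B (e.symm v - x₀) (e.symm v - x₀))
        =o[𝓝 0] fun v => ‖v‖ ^ 2 := by
      refine (hB.comp_tendsto hsymm).trans_isBigO ?_
      have := (hO.norm_norm).pow 2
      simp only [sub_zero] at this
      exact this
    have hab : (fun v => (e.symm v - x₀) - M.symm v) =o[𝓝 0] fun v => v - 0 := by
      have := hderiv0.isLittleO
      simpa [he0] using this
    have h2 := (isLittleO_bilin_sub B hO hab).const_mul_left (1 / 2 : ℝ)
    simp only [sub_zero] at h2
    refine (h1.add h2).congr_left fun v => ?_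
    ring

end Reparametrisation

section Image

variable {n : ℕ}

/-- In the chart the image is parametrised by `x ↦ (Y x, X x)`, and `e` inverts `X`. Conversely, a
point satisfying the graph equation has the coordinates of an image point, so injectivity of the
chart puts it in the image. -/
theorem isGraphAt_image {g : SOW n} {S : Hyp n} {f : EX n → ℝ}
    (hS : S.pt ∈ (stereo n).source) (hf : IsGraphAt (stereo n) S.carrier S.pt f)
    (hpt : actFun g S.pt = origin n) {X : EX n → EX n} {Y : EX n → ℝ}
    (hXY : ∀ x, stereoFun (actFun g (stereoInv (f x, x))) = (Y x, X x))
    {e : OpenPartialHomeomorph (EX n) (EX n)} (he : (stereoFun S.pt).2 ∈ e.source)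
    (heX : ∀ x, e x = X x)
    (hsm : ∀ᶠ v in 𝓝 0, ContDiffAt ℝ ∞ (fun v => Y (e.symm v)) v) :
    IsGraphAt (stereo n) (moveHyp g S).carrier (origin n) (fun v => Y (e.symm v)) := by
  have ho : stereo n (origin n) = (0, 0) := by
    change stereoFun (origin n) = (0, 0)
    simp [stereoFun, origin]
  have hos : origin n ∈ (stereo n).source := by
    change ct (mkV 0 (0 : EX n) 1) ≠ -1
    rw [ct_mkV]
    norm_num
  set z₀ := stereoFun S.pt with hz₀
  have hz : stereoInv z₀ = S.pt := stereoInv_stereoFun hS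
  have hfz : (f z₀.2, z₀.2) = z₀ := Prod.ext (hf.apply_pt S.mem) rfl
  have hfd : ContDiffAt ℝ ∞ f z₀.2 := hf.1.self_of_nhds
  have hX0 : X z₀.2 = 0 := by
    have := hXY z₀.2
    rw [hfz, hz, hpt] at this
    exact (congrArg Prod.snd (this.symm.trans ho))
  have ht : (0 : EX n) ∈ e.target := by
    have := e.map_source he
    rwa [heX, hX0] at this
  have he0 : e.symm 0 = z₀.2 := by
    rw [← hX0, ← heX]
    exact e.left_inv he
  have hsymm : Tendsto e.symm (𝓝 0) (𝓝 z₀.2) := by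
    have := (e.continuousAt_symm ht).tendsto
    rwa [he0] at this
  have hfc : Tendsto (fun x => (f x, x)) (𝓝 z₀.2) (𝓝 z₀) := by
    conv_rhs => rw [← hfz]
    exact hfd.continuousAt.prodMk_nhds continuousAt_id
  have hst : Tendsto (stereo n) (𝓝 (origin n)) (𝓝 (0, 0)) := by
    have := ((stereo n).continuousAt hos).tendsto
    rwa [ho] at this
  have hst2 : Tendsto (fun y => (stereo n y).2) (𝓝 (origin n)) (𝓝 0) :=
    (continuous_snd.tendsto _).comp hst
  have hig : Tendsto (actFun g⁻¹) (𝓝 (origin n)) (𝓝 S.pt) := by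
    have := (contMDiff_actFun g⁻¹).continuous.tendsto (origin n)
    rwa [← hpt, actFun_inv, hpt] at this
  have hig2 : Tendsto (fun y => (stereoFun (actFun g⁻¹ y)).2) (𝓝 (origin n)) (𝓝 z₀.2) :=
    (continuous_snd.tendsto _).comp
      ((((stereo n).continuousAt hS).tendsto).comp hig)
  have hgo : Tendsto (fun x => actFun g (stereoInv (f x, x))) (𝓝 z₀.2) (𝓝 (origin n)) := by
    have h1 := ((contMDiff_actFun g).continuous.comp
      (continuous_stereoInv (n := n))).tendsto z₀
    rw [Function.comp_apply, hz, hpt] at h1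
    exact h1.comp hfc
  refine ⟨by rw [ho]; exact hsm, ?_⟩
  filter_upwards [hig ((stereo n).open_source.mem_nhds hS), hig.eventually hf.2,
    hig2 (e.open_source.mem_nhds he), hst2 (e.open_target.mem_nhds ht),
    (hsymm.comp hst2).eventually (hfc.eventually (hf.eventually_stereoInv hS)),
    (hsymm.comp hst2) (hgo ((stereo n).open_source.mem_nhds hos)),
    (stereo n).open_source.mem_nhds hos] with y h1 h2 h3 h4 h5 h6 h7
  have hy : actFun g (actFun g⁻¹ y) = y := (actHomeo g).right_inv y
  have hmem : y ∈ (moveHyp g S).carrier ↔ actFun g⁻¹ y ∈ S.carrier := by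
    constructor
    · rintro ⟨y', hy', rfl⟩
      rwa [actFun_inv]
    · intro h
      exact ⟨_, h, hy⟩
  rw [hmem]
  constructor
  · intro hyS
    set z := stereoFun (actFun g⁻¹ y) with hzdef
    have hzf : z = (f z.2, z.2) := Prod.ext (h2.1 hyS) rfl
    have hzy : stereoInv z = actFun g⁻¹ y := stereoInv_stereoFun h1
    have h8 : stereo n y = (Y z.2, X z.2) := by
      rw [← hXY, ← hzf, hzy, hy]
      rfl
    rw [h8]
    simp only
    rw [← heX, e.left_inv h3]
  · intro hyY
    set x := e.symm (stereo n y).2 with hx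
    have h8 : stereo n y = (Y x, X x) := by
      refine Prod.ext hyY ?_
      change _ = X x
      rw [← heX, hx, e.right_inv h4]
    have h9 : stereo n y = stereo n (actFun g (stereoInv (f x, x))) := h8.trans (hXY x).symm
    have h10 := (stereo n).injOn h7 h6 h9
    have h11 : stereoInv (f x, x) ∈ S.carrier := h5.2 rfl
    rw [h10]
    change actFun g⁻¹ (actFun g (stereoInv (f x, x))) ∈ S.carrier
    rwa [actFun_inv]

end Image

/-! ### The coordinates of the image of a jet -/

variable {n : ℕ}

theorem wu_eplus : wu (eplus : W n) = 0 := by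
  rw [wu_apply, eplus, cu_mkV]

theorem wx_eplus : wx (eplus : W n) = 0 := by
  rw [wx_apply, eplus, cx_mkV]

/-- If the tangent vectors to a hypersurface are sent to the hyperplane `u = 0`, then the normal
vectors are not. -/
theorem wu_dcone_ne_zero {A : W n ≃ₗ[ℝ] W n} (hA : ∀ w, lorentz (A w) = lorentz w)
    {z : ℝ × EX n} {c : ℝ} (hz : A (cone z) = c • eplus) {p : EX n →L[ℝ] ℝ}
    (htan : ∀ ξ, wu (A (dcone z (p ξ, ξ))) = 0) : wu (A (dcone z (1, 0))) ≠ 0 := by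
  intro h0
  have hall : ∀ τ, wu (A (dcone z τ)) = 0 := by
    intro τ
    have h1 : dcone z τ = (τ.1 - p τ.2) • dcone z (1, 0) + dcone z (p τ.2, τ.2) := by
      simp only [← dconeL_apply, ← map_smul, ← map_add]
      congr 1
      refine Prod.ext ?_ ?_ <;> simp
    rw [h1, map_add, map_add, map_smul, map_smul, h0, htan]
    simp
  -- The preimage `w` of `∂_u` is orthogonal to `cone z`, because `∂_u` is orthogonal to `eplus`. It
  -- thus has no `eminus` component and combines vectors whose images all have `u = 0`, a
  -- contradiction.
  obtain ⟨w, hw⟩ := A.surjective ((0, mkV 1 0 0) : W n)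
  have hcw : lor (cone z) w = 0 := by
    rw [← lor_map hA, hz, hw, lor_comm, lor_smul_right, lor_eplus]
    simp
  obtain ⟨α, β, τ, hdec⟩ := exists_decomposition z w
  have hβ : β = 0 := by
    rw [hdec, lor_add_right, lor_add_right, lor_smul_right, lor_smul_right, lor_cone_eminus,
      lor_comm, lor_comm _ (dcone z τ), lor_dcone_cone] at hcw
    have h1 : lor (cone z) (cone z) = 0 := by
      rw [← lor_map hA, hz, lor_smul_right, lor_eplus]
      simp [eplus, ct_smul]
    rw [h1] at hcw
    linarith
  have h1 : wu (A w) = 0 := by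
    rw [hdec, hβ, zero_smul, add_zero, map_add, map_add, map_smul, map_smul, hz, hall, map_smul,
      wu_eplus]
    simp
  rw [hw, wu_apply] at h1
  simp at h1

/-- The differential of the image of a graph is a similarity for the metric of the graph. -/
theorem inner_wx_dcone {A : W n ≃ₗ[ℝ] W n} (hA : ∀ w, lorentz (A w) = lorentz w)
    {z : ℝ × EX n} {c : ℝ} (hz : A (cone z) = c • eplus) (hc : c ≠ 0) {p : EX n →L[ℝ] ℝ}
    (htan : ∀ ξ, wu (A (dcone z (p ξ, ξ))) = 0) (ξ η : EX n) :
    inner ℝ (wx (A (dcone z (p ξ, ξ)))) (wx (A (dcone z (p η, η)))) =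
      16 * (p ξ * p η + inner ℝ ξ η) := by
  have h1 := lor_map hA (dcone z (p ξ, ξ)) (dcone z (p η, η))
  rw [lor_dcone_dcone] at h1
  -- Orthogonality to `eplus` means `lam = t`, so these two coordinates cancel in the Lorentzian
  -- form; with `u = 0` only the `x` part remains.
  have h2 : ∀ τ, (A (dcone z τ)).1 = ct (A (dcone z τ)).2 := by
    intro τ
    have h3 := lor_map hA (dcone z τ) (cone z)
    rw [lor_dcone_cone, hz, lor_smul_right, lor_eplus] at h3
    rcases mul_eq_zero.1 h3 with h | h
    · exact absurd h hc
    · linarith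
  have h3 := htan ξ
  rw [wu_apply] at h3
  rw [lor_eq, h2, h2, h3] at h1
  rw [wx_apply, wx_apply]
  linarith

/-- The constants match because `‖M ξ‖² = (16 / l²)(p² + N)`: the term `μ (p² + N)` of the cone is
`l · (1/2) · (μ l / 8) ‖M ξ‖²`. -/
theorem expansion_identity {l : ℝ} (hl : l ≠ 0) (κ μ r D p N : ℝ) :
    κ * (r - (1 / 2) * D) + μ * ((2 * p + r) * r) = r * κ + μ * ((p + r) ^ 2 + N) -
      l * ((1 / 2) * (κ / l * D + μ * l / 8 * (16 / l ^ 2 * (p * p + N)))) := by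
  field_simp
  ring

theorem quotient_identity {l : ℝ} (hl : l ≠ 0) (d N B : ℝ) :
    (2 / d - l⁻¹) * N + l⁻¹ * (N - l * ((1 / 2) * B)) = 2 / d * N - (1 / 2) * B := by
  have : l⁻¹ * (N - l * ((1 / 2) * B)) = l⁻¹ * N - (1 / 2) * B := by
    rw [mul_sub, inv_mul_cancel_left₀ hl]
  rw [this]
  ring

set_option maxHeartbeats 1000000 in
/-- An element of `SO(1, n+2)` which sends the tangent hyperplane at a point of a graph to the
tangent hyperplane of the equator at the origin sends the graph to a graph with a critical point,
and its second derivatives are those of the initial graph up to a similarity, a factor and a multiple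
of the identity. -/
theorem exists_image_graph {g : SOW n} {S : Hyp n} {f : EX n → ℝ}
    (hS : S.pt ∈ (stereo n).source) (hf : IsGraphAt (stereo n) S.carrier S.pt f)
    (hpt : actFun g S.pt = origin n)
    (htan : ∀ ξ, wu ((g : W n ≃ₗ[ℝ] W n) (dcone (stereoFun S.pt)
      (fderiv ℝ f (stereoFun S.pt).2 ξ, ξ))) = 0) :
    ∃ (f' : EX n → ℝ) (M : EX n ≃L[ℝ] EX n) (c k : ℝ),
      IsGraphAt (stereo n) (moveHyp g S).carrier (origin n) f' ∧ f' 0 = 0 ∧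
      fderiv ℝ f' 0 = 0 ∧ c ≠ 0 ∧ 0 < k ∧
      (∀ ξ η, inner ℝ (M ξ) (M η) = k * (fderiv ℝ f (stereoFun S.pt).2 ξ *
        fderiv ℝ f (stereoFun S.pt).2 η + inner ℝ ξ η)) ∧
      ∀ v w, fderiv ℝ (fderiv ℝ f') 0 v w =
        c * fderiv ℝ (fderiv ℝ f) (stereoFun S.pt).2 (M.symm v) (M.symm w) +
          (wu ((g : W n ≃ₗ[ℝ] W n) eminus) *
            ((g : W n ≃ₗ[ℝ] W n) (cone (stereoFun S.pt))).1 / 8) * inner ℝ v w := by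
  have hA := g.2.1
  set A : W n ≃ₗ[ℝ] W n := (g : W n ≃ₗ[ℝ] W n) with hAdef
  set z₀ := stereoFun S.pt with hz₀
  have hz : stereoInv z₀ = S.pt := stereoInv_stereoFun hS
  have hfz : (f z₀.2, z₀.2) = z₀ := Prod.ext (hf.apply_pt S.mem) rfl
  have hf1 : f z₀.2 = z₀.1 := hf.apply_pt S.mem
  have hfd : ContDiffAt ℝ ∞ f z₀.2 := hf.1.self_of_nhds
  have hfev : ∀ᶠ x in 𝓝 z₀.2, ContDiffAt ℝ ∞ f x := hf.1
  set x₀ := z₀.2 with hx₀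
  set p := fderiv ℝ f x₀ with hp
  set D := fderiv ℝ (fderiv ℝ f) x₀ with hD
  have hfd' : HasFDerivAt f p x₀ := (hfd.differentiableAt (by simp)).hasFDerivAt
  obtain ⟨hA0, hl⟩ : A (cone z₀) = (A (cone z₀)).1 • eplus ∧ (A (cone z₀)).1 ≠ 0 :=
    map_cone_of_actFun_eq_origin (by rw [hz, hpt])
  set l := (A (cone z₀)).1 with hl_def
  -- To second order the `u` coordinate of the image responds to the Hessian of `f` with the factor
  -- `κ`, and to the quadratic term of the cone with the factor `μ`.
  set κ := wu (A (dcone z₀ (1, 0))) with hκ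
  set μ := wu (A eminus) with hμ
  have hκ0 : κ ≠ 0 := wu_dcone_ne_zero hA hA0 htan
  have hinner := inner_wx_dcone hA hA0 hl htan
  set AL : W n →L[ℝ] W n := LinearMap.toContinuousLinearMap (A : W n →ₗ[ℝ] W n) with hAL
  -- the curve of null vectors over the graph
  set γ : EX n → W n := fun x => A (cone (f x, x)) with hγ
  have hγ0 : γ x₀ = l • eplus := by
    rw [hγ]
    simp only
    rw [hfz, hA0]
  have hγd : HasFDerivAt γ (AL.comp ((dconeL z₀).comp (p.prod (ContinuousLinearMap.id ℝ _)))) x₀ := by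
    have h1 : HasFDerivAt (fun x => (f x, x)) (p.prod (ContinuousLinearMap.id ℝ _)) x₀ :=
      hfd'.prodMk (hasFDerivAt_id x₀)
    have h2 : HasFDerivAt cone (dconeL z₀) (f x₀, x₀) := by
      rw [hfz]
      exact hasFDerivAt_cone z₀
    exact AL.hasFDerivAt.comp x₀ (HasFDerivAt.comp (f := fun x => (f x, x)) x₀ h2 h1)
  have hγs : ∀ᶠ x in 𝓝 x₀, ContDiffAt ℝ ∞ γ x := by
    filter_upwards [hfev] with x hx
    exact AL.contDiff.contDiffAt.comp x
      (contDiff_cone.contDiffAt.comp x (hx.prodMk contDiffAt_id))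
  have hd0 : wd (γ x₀) = 2 * l := by
    rw [hγ0, map_smul, wd_apply]
    simp [eplus]
    ring
  have hγc : ContinuousAt γ x₀ := hγd.continuousAt
  have hdc : Tendsto (fun x => wd (γ x)) (𝓝 x₀) (𝓝 (2 * l)) := by
    rw [← hd0]
    exact (wd.continuous.tendsto _).comp hγc
  have h2l : 2 * l ≠ 0 := mul_ne_zero two_ne_zero hl
  have hdne : ∀ᶠ x in 𝓝 x₀, wd (γ x) ≠ 0 := hdc.eventually_ne h2l
  set Y : EX n → ℝ := fun x => (2 / wd (γ x)) * wu (γ x) with hY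
  set X : EX n → EX n := fun x => (2 / wd (γ x)) • wx (γ x) with hX
  have hXY : ∀ x, stereoFun (actFun g (stereoInv (f x, x))) = (Y x, X x) :=
    fun x => stereoFun_actFun g (f x, x)
  have hqs : ∀ᶠ x in 𝓝 x₀, ContDiffAt ℝ ∞ (fun x => 2 / wd (γ x)) x := by
    filter_upwards [hγs, hdne] with x h1 h2
    exact contDiffAt_const.div (wd.contDiff.contDiffAt.comp x h1) h2
  have hYs : ∀ᶠ x in 𝓝 x₀, ContDiffAt ℝ ∞ Y x := by
    filter_upwards [hγs, hqs] with x h1 h2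
    exact h2.mul (wu.contDiff.contDiffAt.comp x h1)
  have hXs : ∀ᶠ x in 𝓝 x₀, ContDiffAt ℝ ∞ X x := by
    filter_upwards [hγs, hqs] with x h1 h2
    exact h2.smul (wx.contDiff.contDiffAt.comp x h1)
  have hX0 : X x₀ = 0 := by
    simp only [hX]
    rw [hγ0, map_smul wx, wx_eplus, smul_zero, smul_zero]
  -- the differential of the parametrisation
  set T : EX n →L[ℝ] EX n :=
    wx.comp (AL.comp ((dconeL z₀).comp (p.prod (ContinuousLinearMap.id ℝ _)))) with hT
  have hTa : ∀ ξ, T ξ = wx (A (dcone z₀ (p ξ, ξ))) := fun ξ => rfl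
  have hTinj : Function.Injective (l⁻¹ • T : EX n →L[ℝ] EX n) := by
    rw [injective_iff_map_eq_zero]
    intro ξ hξ
    have h1 : T ξ = 0 := by
      have := (smul_eq_zero.1 (show l⁻¹ • T ξ = 0 from hξ)).resolve_left (inv_ne_zero hl)
      exact this
    have h2 := hinner ξ ξ
    rw [← hTa, h1, inner_zero_left, real_inner_self_eq_norm_sq] at h2
    have h3 : ‖ξ‖ ^ 2 = 0 := by nlinarith [mul_self_nonneg (p ξ), sq_nonneg ‖ξ‖]
    simpa using h3
  set M : EX n ≃L[ℝ] EX n :=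
    (LinearEquiv.ofInjectiveEndo ((l⁻¹ • T : EX n →L[ℝ] EX n) : EX n →ₗ[ℝ] EX n)
      hTinj).toContinuousLinearEquiv with hM
  have hMa : ∀ ξ, M ξ = l⁻¹ • T ξ := fun ξ => rfl
  have hXd : HasFDerivAt X (M : EX n →L[ℝ] EX n) x₀ := by
    have h1 : HasFDerivAt (fun x => wx (γ x)) T x₀ := wx.hasFDerivAt.comp x₀ hγd
    have h2 : DifferentiableAt ℝ (fun x => 2 / wd (γ x)) x₀ :=
      hqs.self_of_nhds.differentiableAt (by simp)
    refine (h2.hasFDerivAt.smul h1).congr_fderiv ?_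
    ext1 ξ
    have h3 : wx (γ x₀) = 0 := by
      rw [hγ0, map_smul, wx_eplus, smul_zero]
    have h4 : 2 / wd (γ x₀) = l⁻¹ := by
      rw [hd0]
      field_simp
    rw [h3, h4]
    simp [hMa]
  have hMin : ∀ ξ η, inner ℝ (M ξ) (M η) = 16 / l ^ 2 * (p ξ * p η + inner ℝ ξ η) := by
    intro ξ η
    rw [hMa, hMa, real_inner_smul_left, real_inner_smul_right, hTa, hTa, hinner]
    field_simp
  -- the expansion of `Y`
  set r : EX n → ℝ := fun x => f x - z₀.1 - p (x - x₀) with hr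
  -- This is an exact identity: the zeroth order term and the tangential part `p (x - x₀)`
  -- contribute nothing to `u`, by `hA0` and `htan`.
  have hγu : ∀ x, wu (γ x) = r x * κ + μ * ((p (x - x₀) + r x) ^ 2 + ‖x - x₀‖ ^ 2) := by
    intro x
    have h1 : ((f x, x) : ℝ × EX n) = z₀ + (p (x - x₀) + r x, x - x₀) := by
      refine Prod.ext ?_ ?_
      · simp [hr]
      · simp [hx₀]
    have h2 : dcone z₀ (p (x - x₀) + r x, x - x₀) =
        dcone z₀ (p (x - x₀), x - x₀) + r x • dcone z₀ (1, 0) := by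
      simp only [← dconeL_apply, ← map_smul, ← map_add]
      congr 1
      refine Prod.ext ?_ ?_ <;> simp
    have h3 : wu (A (cone z₀)) = 0 := by
      rw [hA0, map_smul, wu_eplus, smul_zero]
    simp only [hγ]
    rw [h1, cone_add, h2]
    simp only [map_add, map_smul, h3, htan, smul_eq_mul, ← hκ, ← hμ]
    ring
  have hr2 : (fun x => r x - (1 / 2) * D (x - x₀) (x - x₀)) =o[𝓝 x₀] fun x => ‖x - x₀‖ ^ 2 := by
    refine (taylor_two_isLittleO (hfd.of_le two_le_infty)).congr_left fun x => ?_
    rw [hf1]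
  have hr1 : r =o[𝓝 x₀] fun x => ‖x - x₀‖ := by
    refine (hfd'.isLittleO.norm_right).congr_left fun x => ?_
    rw [hf1]
  have hpO : (fun x => p (x - x₀)) =O[𝓝 x₀] fun x => ‖x - x₀‖ :=
    (p.isBigO_comp (fun x => x - x₀) _).norm_right
  -- As `wd (γ x)` tends to `2 l`, the function `Y` is `l⁻¹ wu (γ x)` to second order; `hMin`
  -- rewrites the metric of the graph through `M`.
  set B : EX n →L[ℝ] EX n →L[ℝ] ℝ :=
    (κ / l) • D + (μ * l / 8) • (isBoundedBilinearMap_inner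
      (𝕜 := ℝ) (E := EX n)).toContinuousLinearMap.bilinearComp (M : EX n →L[ℝ] EX n)
      (M : EX n →L[ℝ] EX n) with hB
  have hBa : ∀ ξ η, B ξ η = κ / l * D ξ η + μ * l / 8 * inner ℝ (M ξ) (M η) := fun ξ η => rfl
  have hN : (fun x => wu (γ x) - l * ((1 / 2) * B (x - x₀) (x - x₀)))
      =o[𝓝 x₀] fun x => ‖x - x₀‖ ^ 2 := by
    have h1 := hr2.const_mul_left κ
    have h2 : (fun x => μ * ((2 * p (x - x₀) + r x) * r x)) =o[𝓝 x₀] fun x => ‖x - x₀‖ ^ 2 := by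
      refine Asymptotics.IsLittleO.const_mul_left ?_ μ
      simp_rw [pow_two]
      exact ((hpO.const_mul_left 2).add hr1.isBigO).mul_isLittleO hr1
    refine (h1.add h2).congr_left fun x => ?_
    rw [hγu, hBa, hMin, real_inner_self_eq_norm_sq]
    exact expansion_identity hl _ _ _ _ _ _
  have hNO : (fun x => wu (γ x)) =O[𝓝 x₀] fun x => ‖x - x₀‖ ^ 2 := by
    have h1 : (fun x => l * ((1 / 2) * B (x - x₀) (x - x₀))) =O[𝓝 x₀] fun x => ‖x - x₀‖ ^ 2 := by
      refine Asymptotics.IsBigO.of_bound (|l| * (1 / 2 * ‖B‖)) (Eventually.of_forall fun x => ?_)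
      have := B.le_opNorm₂ (x - x₀) (x - x₀)
      rw [norm_mul, norm_mul, Real.norm_eq_abs l]
      rw [norm_pow, norm_norm, pow_two, mul_assoc, mul_assoc]
      refine mul_le_mul_of_nonneg_left ?_ (abs_nonneg _)
      have h3 : ‖(1 / 2 : ℝ)‖ = 1 / 2 := by norm_num
      rw [h3]
      linarith
    have := hN.isBigO.add h1
    simpa using this
  have hYB : (fun x => Y x - (1 / 2) * B (x - x₀) (x - x₀)) =o[𝓝 x₀] fun x => ‖x - x₀‖ ^ 2 := by
    -- Replacing `2 / wd (γ x)` by its limit is harmless, because the numerator `wu (γ x)` is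
    -- already `O(‖x - x₀‖²)`.
    have h1 : (fun x => 2 / wd (γ x) - l⁻¹) =o[𝓝 x₀] fun _ => (1 : ℝ) := by
      rw [Asymptotics.isLittleO_one_iff]
      have h2 : Tendsto (fun x => 2 / wd (γ x)) (𝓝 x₀) (𝓝 (2 / (2 * l))) :=
        tendsto_const_nhds.div hdc h2l
      have h3 : 2 / (2 * l) - l⁻¹ = 0 := by
        field_simp
        ring
      rw [← h3]
      exact h2.sub_const _
    have h2 := h1.mul_isBigO hNO
    simp only [one_mul] at h2
    refine (h2.add (hN.const_mul_left l⁻¹)).congr_left fun x => ?_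
    exact quotient_identity hl _ _ _
  obtain ⟨e, hes, heX, hsm, hexp⟩ := exists_reparametrisation hXs hYs hX0 hXd hYB
  have hgraph := isGraphAt_image hS hf hpt hXY hes heX hsm
  set f' : EX n → ℝ := fun v => Y (e.symm v) with hf'
  have hf'2 : ContDiffAt ℝ 2 f' 0 := hsm.self_of_nhds.of_le two_le_infty
  have hDs : ∀ v w, D v w = D w v := symm_fderiv_fderiv (hfd.of_le two_le_infty)
  set B' : EX n →L[ℝ] EX n →L[ℝ] ℝ :=
    B.bilinearComp (M.symm : EX n →L[ℝ] EX n) (M.symm : EX n →L[ℝ] EX n) with hB'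
  have hB'a : ∀ v w, B' v w = B (M.symm v) (M.symm w) := fun v w => rfl
  obtain ⟨k1, k2, k3⟩ := eq_of_expansion_two hf'2 (a := 0) (p := 0) (q := fun v => B' v v)
    (fun t ξ => by simp; ring) (by
      refine hexp.congr ?_ ?_
      · intro v
        simp [hB'a, hf']
      · intro v
        simp)
  have k4 : fderiv ℝ (fderiv ℝ f') 0 = B' := by
    refine eq_of_diag_eq (symm_fderiv_fderiv hf'2) ?_ k3
    intro v w
    rw [hB'a, hB'a, hBa, hBa, hDs, real_inner_comm]
  refine ⟨f', M, κ / l, 16 / l ^ 2, hgraph, k1, k2, div_ne_zero hκ0 hl, by positivity, hMin, ?_⟩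
  intro v w
  rw [k4, hB'a, hBa]
  simp

/-! ### Elements of `SO(1, n+2)` -/

section Group

variable {n : ℕ}

/-- A rotation of the sphere as an element of `SO(1, n+2)`. -/
def rotation (R : V n ≃ₗᵢ[ℝ] V n) (hR : LinearMap.det R.toLinearMap = 1) : SOW n :=
  ⟨(LinearEquiv.refl ℝ ℝ).prodCongr R.toLinearEquiv, by
    constructor
    · intro w
      simp [lorentz]
    · ext
      rw [LinearEquiv.coe_det]
      have : (((LinearEquiv.refl ℝ ℝ).prodCongr R.toLinearEquiv : W n ≃ₗ[ℝ] W n) :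
          W n →ₗ[ℝ] W n) = LinearMap.prodMap LinearMap.id R.toLinearMap := rfl
      rw [this, LinearMap.det_prodMap, LinearMap.det_id, hR]
      simp⟩

theorem rotation_apply (R : V n ≃ₗᵢ[ℝ] V n) (hR : LinearMap.det R.toLinearMap = 1) (w : W n) :
    (rotation R hR : W n ≃ₗ[ℝ] W n) w = (w.1, R w.2) := rfl

theorem mkV_add (u u' : ℝ) (x x' : EX n) (t t' : ℝ) :
    mkV u x t + mkV u' x' t' = mkV (u + u') (x + x') (t + t') := by
  rw [← mkV_eta (mkV u x t + mkV u' x' t')]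
  simp [cu_add, cx_add, ct_add]

theorem inner_mkV (u u' : ℝ) (x x' : EX n) (t t' : ℝ) :
    inner ℝ (mkV u x t) (mkV u' x' t') = u * u' + inner ℝ x x' + t * t' := by
  have h := real_inner_eq_norm_add_mul_self_sub_norm_mul_self_sub_norm_mul_self_div_two
    (mkV u x t) (mkV u' x' t')
  rw [h, mkV_add, ← pow_two, ← pow_two, ← pow_two, normSq_mkV, normSq_mkV, normSq_mkV,
    norm_add_sq_real]
  ring

theorem norm_mkV_one_zero : ‖mkV 1 (0 : EX n) 0‖ = 1 := by
  have h := normSq_mkV 1 (0 : EX n) 0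
  have h0 := norm_nonneg (mkV 1 (0 : EX n) 0)
  simp only [norm_zero] at h
  nlinarith

/-- A rotation carries any point and any unit tangent vector to the origin and `± ∂_u`. -/
theorem exists_rotation {ν y : V n} (hν : ‖ν‖ = 1) (hy : ‖y‖ = 1) (hνy : inner ℝ ν y = 0) :
    ∃ (R : V n ≃ₗᵢ[ℝ] V n) (s : ℝ), LinearMap.det R.toLinearMap = 1 ∧ R y = mkV 0 0 1 ∧
      ∀ w, cu (R w) = s * inner ℝ ν w := by
  classical
  -- Index `0` is the coordinate `u` and the last index is `t`; `ν` and `y` are completed to an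
  -- orthonormal basis with these labels.
  set v : Fin (n + 1 + 1) → V n := fun i => if i = 0 then ν else y with hv
  have hlast : (Fin.last (n + 1) : Fin (n + 1 + 1)) ≠ 0 := (Fin.last_pos).ne'
  have hv0 : v 0 = ν := if_pos rfl
  have hvl : v (Fin.last (n + 1)) = y := if_neg hlast
  have hort : Orthonormal ℝ (({0, Fin.last (n + 1)} : Set (Fin (n + 1 + 1))).domRestrict v) := by
    constructor
    · rintro ⟨i, rfl | rfl⟩
      · simpa [hv0] using hν
      · simpa [hvl] using hy
    · rintro ⟨i, rfl | rfl⟩ ⟨j, rfl | rfl⟩ hij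
      · exact absurd rfl hij
      · simpa [hv0, hvl] using hνy
      · simpa [hv0, hvl, real_inner_comm] using hνy
      · exact absurd rfl hij
  obtain ⟨b, hb⟩ := hort.exists_orthonormalBasis_extension_of_card_eq (by simp)
  have hb0 : b 0 = ν := by rw [hb 0 (by simp), hv0]
  have hbl : b (Fin.last (n + 1)) = y := by rw [hb _ (by simp), hvl]
  have hcu : ∀ w, cu (b.repr w) = inner ℝ ν w := by
    intro w
    rw [cu, b.repr_apply_apply, hb0]
  have hRy : b.repr y = mkV 0 0 1 := by
    rw [← hbl, b.repr_self]
    rw [← mkV_eta (EuclideanSpace.single (Fin.last (n + 1)) (1 : ℝ))]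
    have h1 : cu (EuclideanSpace.single (Fin.last (n + 1)) (1 : ℝ)) = 0 := by
      simp [cu, hlast.symm]
    have h2 : cx (EuclideanSpace.single (Fin.last (n + 1)) (1 : ℝ)) = 0 := by
      ext i
      simp [cx]
    have h3 : ct (EuclideanSpace.single (Fin.last (n + 1)) (1 : ℝ)) = 1 := by
      simp [ct]
    rw [h1, h2, h3]
  have hdet : |LinearMap.det b.repr.toLinearMap| = 1 := by
    rw [← LinearMap.normDet_eq_abs_det]
    exact b.repr.toLinearIsometry.normDet_eq_one
  -- If the determinant is `-1`, composing with the reflection in `u = 0` corrects it; this fixes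
  -- the origin and only changes the sign of `u`.
  rcases eq_or_eq_neg_of_abs_eq hdet with h | h
  · exact ⟨b.repr, 1, h, hRy, fun w => by rw [hcu, one_mul]⟩
  · set e : V n := mkV 1 0 0 with he
    set K : Submodule ℝ (V n) := (Submodule.span ℝ {e})ᗮ with hK
    have he1 : ‖e‖ = 1 := norm_mkV_one_zero
    have he0 : e ≠ 0 := by
      intro h0
      rw [h0] at he1
      simp at he1
    have hdetK : LinearMap.det K.reflection.toLinearMap = -1 := by
      have := Submodule.det_reflection (𝕜 := ℝ) K
      rw [this, hK, Submodule.orthogonal_orthogonal, finrank_span_singleton he0, pow_one]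
    have hec : ∀ w, cu w = inner ℝ e w := by
      intro w
      rw [← mkV_eta w, he, inner_mkV]
      simp
    refine ⟨b.repr.trans K.reflection, -1, ?_, ?_, ?_⟩
    · have : (b.repr.trans K.reflection).toLinearMap =
          K.reflection.toLinearMap ∘ₗ b.repr.toLinearMap := rfl
      rw [this, LinearMap.det_comp, hdetK, h]
      norm_num
    · rw [LinearIsometryEquiv.trans_apply, hRy]
      refine Submodule.reflection_mem_subspace_eq_self ?_
      rw [hK, Submodule.mem_orthogonal_singleton_iff_inner_right, he, inner_mkV]
      simp
    · intro w
      rw [LinearIsometryEquiv.trans_apply, hec]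
      have h1 : K.reflection e = -e := Submodule.reflection_orthogonalComplement_singleton_eq_neg e
      have h2 := K.reflection.inner_map_map e (b.repr w)
      rw [h1, inner_neg_left] at h2
      rw [← hcu w, hec]
      linarith

/-- The group `SO(1, n+2)` is transitive on the `1`-jets of graphs. -/
theorem exists_map_tangent (z : ℝ × EX n) (p : EX n →L[ℝ] ℝ) :
    ∃ g : SOW n, actFun g (stereoInv z) = origin n ∧
      ∀ ξ, wu ((g : W n ≃ₗ[ℝ] W n) (dcone z (p ξ, ξ))) = 0 := by
  set y : V n := (stereoInv z : V n) with hy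
  have hy1 : ‖y‖ = 1 := norm_coe _
  -- The Euclidean normal to the hyperplane of the vectors `(p ξ, ξ)`.
  set σ : ℝ × EX n := (1, -((InnerProductSpace.toDual ℝ (EX n)).symm p)) with hσ
  have hσp : ∀ ξ, inner ℝ σ.2 ξ = -p ξ := by
    intro ξ
    rw [hσ, inner_neg_left, InnerProductSpace.toDual_symm_apply]
  have hlor : ∀ v w : W n, lor v w = inner ℝ v.2 w.2 - v.1 * w.1 := by
    intro v w
    rw [lor_eq]
    conv_rhs => rw [← mkV_eta v.2, ← mkV_eta w.2, inner_mkV]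
    ring
  have hyd : ∀ τ, inner ℝ y (dcone z τ).2 = (dcone z τ).1 := by
    intro τ
    have h1 : lor (dcone z τ) (lift (stereoInv z)) = 0 := by
      rw [lift_stereoInv, lor_smul_right, lor_dcone_cone, mul_zero]
    rw [hlor, real_inner_comm] at h1
    change inner ℝ y (dcone z τ).2 - (dcone z τ).1 * 1 = 0 at h1
    linarith
  -- Subtracting a multiple of the null vector `(1, y)` from `dcone z σ` kills the `lam` component
  -- and leaves a vector tangent to the sphere. Pairings with the `dcone z τ` do not change, since
  -- these are orthogonal to that null vector.
  set ν : V n := (dcone z σ).2 - (dcone z σ).1 • y with hν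
  have hνd : ∀ τ, inner ℝ ν (dcone z τ).2 = 16 * (σ.1 * τ.1 + inner ℝ σ.2 τ.2) := by
    intro τ
    rw [hν, inner_sub_left, real_inner_smul_left, hyd, ← lor_dcone_dcone z, hlor]
  have hνy : inner ℝ ν y = 0 := by
    rw [hν, inner_sub_left, real_inner_smul_left, real_inner_comm, hyd, real_inner_self_eq_norm_sq,
      hy1]
    ring
  have hν0 : ‖ν‖ ≠ 0 := by
    intro h0
    have h1 := hνd σ
    rw [norm_eq_zero.1 h0, inner_zero_left, real_inner_self_eq_norm_sq] at h1
    have : σ.1 = 1 := rfl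
    rw [this] at h1
    nlinarith [sq_nonneg ‖σ.2‖]
  obtain ⟨R, s, hdet, hRy, hRc⟩ := exists_rotation (ν := ‖ν‖⁻¹ • ν) (y := y)
    (by rw [norm_smul, norm_inv, norm_norm, inv_mul_cancel₀ hν0]) hy1
    (by rw [real_inner_smul_left, hνy, mul_zero])
  refine ⟨rotation R hdet, ?_, ?_⟩
  · apply Subtype.ext
    change ((1 : ℝ))⁻¹ • R y = mkV 0 0 1
    rw [hRy, inv_one, one_smul]
  · intro ξ
    rw [rotation_apply, wu_apply, hRc, real_inner_smul_left, hνd, hσp]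
    simp [hσ]

/-- The null translations, which fix the origin and the tangent hyperplane of the equator. -/
def nullTranslation (m : ℝ) (w : W n) : W n :=
  w + (m / 2 * cu w.2 + m ^ 2 / 8 * (w.1 - ct w.2)) • eplus +
    (m / 2 * (w.1 - ct w.2)) • (0, mkV 1 0 0)

theorem fst_nullTranslation (m : ℝ) (w : W n) : (nullTranslation m w).1 =
    w.1 + (m / 2 * cu w.2 + m ^ 2 / 8 * (w.1 - ct w.2)) := by
  simp [nullTranslation, eplus]

theorem cu_nullTranslation (m : ℝ) (w : W n) : cu (nullTranslation m w).2 =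
    cu w.2 + m / 2 * (w.1 - ct w.2) := by
  simp [nullTranslation, eplus, cu_add, cu_smul]

theorem cx_nullTranslation (m : ℝ) (w : W n) : cx (nullTranslation m w).2 = cx w.2 := by
  simp [nullTranslation, eplus, cx_add, cx_smul]

theorem ct_nullTranslation (m : ℝ) (w : W n) : ct (nullTranslation m w).2 =
    ct w.2 + (m / 2 * cu w.2 + m ^ 2 / 8 * (w.1 - ct w.2)) := by
  simp [nullTranslation, eplus, ct_add, ct_smul]

theorem nullTranslation_add (m m' : ℝ) (w : W n) :
    nullTranslation m (nullTranslation m' w) = nullTranslation (m + m') w := by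
  refine ext_W ?_ ?_ ?_ ?_ <;>
    simp only [fst_nullTranslation, cu_nullTranslation, cx_nullTranslation, ct_nullTranslation] <;>
    ring

theorem nullTranslation_zero (w : W n) : nullTranslation 0 w = w := by
  simp [nullTranslation]

/-- The null translations as linear equivalences. -/
def nullTranslationEquiv (m : ℝ) : W n ≃ₗ[ℝ] W n where
  toFun := nullTranslation m
  invFun := nullTranslation (-m)
  left_inv w := by rw [nullTranslation_add, neg_add_cancel, nullTranslation_zero]
  right_inv w := by rw [nullTranslation_add, add_neg_cancel, nullTranslation_zero]
  map_add' v w := by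
    refine ext_W ?_ ?_ ?_ ?_ <;>
      simp only [fst_nullTranslation, cu_nullTranslation, cx_nullTranslation, ct_nullTranslation,
        Prod.fst_add, Prod.snd_add, cu_add, cx_add, ct_add] <;>
      ring
  map_smul' c w := by
    refine ext_W ?_ ?_ ?_ ?_ <;>
      simp only [fst_nullTranslation, cu_nullTranslation, cx_nullTranslation, ct_nullTranslation,
        Prod.smul_fst, Prod.smul_snd, cu_smul, cx_smul, ct_smul, smul_eq_mul, RingHom.id_apply] <;>
      ring

/-- A linear map of `W` that conjugates the null translations to their squares. -/
def boost : W n ≃ₗ[ℝ] W n where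
  toFun w := (5 / 2 * w.1 + 3 / 2 * ct w.2,
    mkV (2 * cu w.2) (cx w.2) (5 / 2 * ct w.2 + 3 / 2 * w.1))
  invFun w := (5 / 8 * w.1 - 3 / 8 * ct w.2,
    mkV (cu w.2 / 2) (cx w.2) (5 / 8 * ct w.2 - 3 / 8 * w.1))
  left_inv w := by
    refine ext_W ?_ ?_ ?_ ?_ <;> simp <;> ring
  right_inv w := by
    refine ext_W ?_ ?_ ?_ ?_ <;> simp <;> ring
  map_add' v w := by
    refine ext_W ?_ ?_ ?_ ?_ <;> simp [cu_add, cx_add, ct_add] <;> ring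
  map_smul' c w := by
    refine ext_W ?_ ?_ ?_ ?_ <;> simp [cu_smul, cx_smul, ct_smul] <;> ring

theorem boost_apply (w : W n) : boost w = (5 / 2 * w.1 + 3 / 2 * ct w.2,
    mkV (2 * cu w.2) (cx w.2) (5 / 2 * ct w.2 + 3 / 2 * w.1)) := rfl

theorem boost_mul_nullTranslation (m : ℝ) :
    boost * nullTranslationEquiv m = nullTranslationEquiv (2 * m) * (boost : W n ≃ₗ[ℝ] W n) := by
  ext1 w
  change boost (nullTranslation m w) = nullTranslation (2 * m) (boost w)
  refine ext_W ?_ ?_ ?_ ?_ <;>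
    simp only [fst_nullTranslation, cu_nullTranslation, cx_nullTranslation, ct_nullTranslation,
      boost_apply, cu_mkV, cx_mkV, ct_mkV] <;>
    ring

/-- Conjugation by `boost` shows that the parameters `m` and `2 m` give the same determinant, while
additivity makes the second the square of the first; a unit equal to its square is `1`. -/
theorem det_nullTranslationEquiv (m : ℝ) :
    LinearEquiv.det (nullTranslationEquiv m : W n ≃ₗ[ℝ] W n) = 1 := by
  have h1 := congrArg LinearEquiv.det (boost_mul_nullTranslation (n := n) m)
  have h2 : (nullTranslationEquiv (2 * m) : W n ≃ₗ[ℝ] W n) =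
      nullTranslationEquiv m * nullTranslationEquiv m := by
    ext1 w
    change nullTranslation (2 * m) w = nullTranslation m (nullTranslation m w)
    rw [nullTranslation_add, two_mul]
  rw [h2, map_mul, map_mul, map_mul, mul_comm, mul_left_inj] at h1
  exact left_eq_mul.1 h1

/-- The null translations as elements of `SO(1, n+2)`. -/
def nullTranslationSO (m : ℝ) : SOW n :=
  ⟨nullTranslationEquiv m, by
    refine ⟨fun w => ?_, det_nullTranslationEquiv m⟩
    change lorentz (nullTranslation m w) = lorentz w
    rw [lorentz_eq, lorentz_eq, fst_nullTranslation, cu_nullTranslation, cx_nullTranslation,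
      ct_nullTranslation]
    ring⟩

theorem nullTranslationSO_apply (m : ℝ) (w : W n) :
    ((nullTranslationSO m : SOW n) : W n ≃ₗ[ℝ] W n) w = nullTranslation m w := rfl

end Group

/-! ### The action on the jet coordinates -/

section Coordinates

variable {n : ℕ}

theorem origin_mem_source : origin n ∈ (stereo n).source := by
  change ct (mkV 0 (0 : EX n) 1) ≠ -1
  rw [ct_mkV]
  norm_num

theorem stereoFun_origin : stereoFun (origin n) = (0, 0) := by
  simp [stereoFun, origin]

theorem isGraphAt_fiducial :
    IsGraphAt (stereo n) (fiducial n).carrier (origin n) (fun _ => 0) := by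
  refine ⟨Eventually.of_forall fun _ => contDiffAt_const, ?_⟩
  filter_upwards [(stereo n).open_source.mem_nhds origin_mem_source] with y hy
  have h0 := one_add_ct_ne (y := y) hy
  change cu (y : V n) = 0 ↔ (2 / (1 + ct (y : V n))) * cu (y : V n) = 0
  simp [h0]

/-- An element which sends the `1`-jet of a graph to that of the equator at the origin sends its
tangent hyperplane to the hyperplane `u = 0`. -/
theorem tangent_of_act_eq {g : SOW n} {S : Hyp n} {f : EX n → ℝ} (hS : S.pt ∈ (stereo n).source)
    (hf : IsGraphAt (stereo n) S.carrier S.pt f) (h : act g (jet 1 S) = o1 n) :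
    actFun g S.pt = origin n ∧ ∀ ξ, wu ((g : W n ≃ₗ[ℝ] W n) (dcone (stereoFun S.pt)
      (fderiv ℝ f (stereoFun S.pt).2 ξ, ξ))) = 0 := by
  have hjet : jet 1 (moveHyp g S) = jet 1 (fiducial n) := h
  obtain ⟨hpt, hc⟩ := contact_of_jet_eq (Or.inl rfl) hjet
  change actFun g S.pt = origin n at hpt
  refine ⟨hpt, ?_⟩
  have hc1 := (hc (by change actFun g S.pt ∈ _; rw [hpt]; exact origin_mem_source)).1
  change Contact 1 (moveHyp g S).carrier (fiducial n).carrier (stereoFun (actFun g S.pt)) at hc1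
  rw [hpt, stereoFun_origin] at hc1
  set z₀ := stereoFun S.pt with hz₀
  have hz : stereoInv z₀ = S.pt := stereoInv_stereoFun hS
  have hfz : (f z₀.2, z₀.2) = z₀ := Prod.ext (hf.apply_pt S.mem) rfl
  have hfd : ContDiffAt ℝ ∞ f z₀.2 := hf.1.self_of_nhds
  have hfd' : HasFDerivAt f (fderiv ℝ f z₀.2) z₀.2 := (hfd.differentiableAt (by simp)).hasFDerivAt
  set x₀ := z₀.2 with hx₀
  set p := fderiv ℝ f x₀ with hp
  obtain ⟨hA0, hl⟩ := map_cone_of_actFun_eq_origin (g := g) (z := z₀) (by rw [hz, hpt])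
  set A : W n ≃ₗ[ℝ] W n := (g : W n ≃ₗ[ℝ] W n) with hAdef
  set l := (A (cone z₀)).1 with hl_def
  set AL : W n →L[ℝ] W n := LinearMap.toContinuousLinearMap (A : W n →ₗ[ℝ] W n) with hAL
  set γ : EX n → W n := fun x => A (cone (f x, x)) with hγ
  have hγ0 : γ x₀ = l • eplus := by
    rw [hγ]
    simp only
    rw [hfz, hA0]
  have hfc : Tendsto (fun x => (f x, x)) (𝓝 x₀) (𝓝 z₀) := by
    conv_rhs => rw [← hfz]
    exact hfd.continuousAt.prodMk_nhds continuousAt_id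
  have hγd : HasFDerivAt γ (AL.comp ((dconeL z₀).comp (p.prod (ContinuousLinearMap.id ℝ _)))) x₀ := by
    have h1 : HasFDerivAt (fun x => (f x, x)) (p.prod (ContinuousLinearMap.id ℝ _)) x₀ :=
      hfd'.prodMk (hasFDerivAt_id x₀)
    have h2 : HasFDerivAt cone (dconeL z₀) (f x₀, x₀) := by
      rw [hfz]
      exact hasFDerivAt_cone z₀
    exact AL.hasFDerivAt.comp x₀ (HasFDerivAt.comp (f := fun x => (f x, x)) x₀ h2 h1)
  have hdne : ∀ᶠ x in 𝓝 x₀, wd (γ x) ≠ 0 := by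
    refine ((wd.continuous.tendsto _).comp hγd.continuousAt).eventually_ne ?_
    rw [hγ0, map_smul, wd_apply]
    simp [eplus, hl]
  have hΦ : Tendsto (fun x => stereoFun (actFun g (stereoInv (f x, x)))) (𝓝 x₀) (𝓝 (0, 0)) := by
    have h1 := ((contMDiff_actFun g).continuous.comp (continuous_stereoInv (n := n))).tendsto z₀
    rw [Function.comp_apply, hz, hpt] at h1
    have h2 : Tendsto stereoFun (𝓝 (origin n)) (𝓝 (0, 0)) := by
      have := ((stereo n).continuousAt origin_mem_source).tendsto
      change Tendsto stereoFun (𝓝 (origin n)) (𝓝 (stereoFun (origin n))) at this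
      rwa [stereoFun_origin] at this
    exact h2.comp (h1.comp hfc)
  have hP : HasFDerivAt (fun x => (wu (γ x), wx (γ x)))
      ((wu.prod wx).comp (AL.comp ((dconeL z₀).comp (p.prod (ContinuousLinearMap.id ℝ _))))) x₀ :=
    (wu.prod wx).hasFDerivAt.comp x₀ hγd
  have hPO : (fun x => (wu (γ x), wx (γ x))) =O[𝓝 x₀] fun x => x - x₀ := by
    have h1 := hP.isBigO_sub
    have h2 : (wu (γ x₀), wx (γ x₀)) = 0 := by
      rw [hγ0, map_smul, map_smul, wu_eplus, wx_eplus, smul_zero, smul_zero]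
      rfl
    simpa [h2] using h1
  -- First order contact with `u = 0` bounds the `u` coordinate of an image point by `ε` times its
  -- norm. The common factor `2 / wd (γ x)` cancels, and the pair `(wu, wx)` along `γ` is `O(x -
  -- x₀)`.
  have hlo : (fun x => wu (γ x)) =o[𝓝 x₀] fun x => ‖x - x₀‖ := by
    refine Asymptotics.IsLittleO.trans_isBigO ?_ hPO.norm_right
    rw [Asymptotics.isLittleO_iff]
    intro ε hε
    filter_upwards [hΦ.eventually (hc1 ε hε), hdne, hfc.eventually (hf.eventually_stereoInv hS)]
      with x h1 h2 h3
    have h4 : stereoInv (stereoFun (actFun g (stereoInv (f x, x)))) =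
        actFun g (stereoInv (f x, x)) := stereoInv_stereoFun (actFun_mem_source g (f x, x) h2)
    rw [h4] at h1
    obtain ⟨w, hw, hwz⟩ := h1 ⟨_, h3.2 rfl, rfl⟩
    have hw0 : w.1 = 0 := by
      have h5 : cu (stereoInvAux w) = 0 := hw
      rw [stereoInvAux, smul_mkV, cu_mkV] at h5
      simpa [(stereo_den_pos w).ne'] using h5
    have h5 := (norm_fst_le (w - stereoFun (actFun g (stereoInv (f x, x))))).trans hwz
    rw [Prod.fst_sub, hw0, zero_sub, norm_neg, stereoFun_actFun] at h5
    change ‖2 / wd (γ x) * wu (γ x)‖ ≤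
      ε * ‖(2 / wd (γ x) * wu (γ x), (2 / wd (γ x)) • wx (γ x)) - ((0, 0) : ℝ × EX n)‖ ^ 1 at h5
    have h6 : ((2 / wd (γ x) * wu (γ x), (2 / wd (γ x)) • wx (γ x)) : ℝ × EX n) - (0, 0) =
        (2 / wd (γ x)) • (wu (γ x), wx (γ x)) := by
      rw [Prod.smul_mk, smul_eq_mul]
      exact sub_zero _
    have h7 : 0 < ‖2 / wd (γ x)‖ := norm_pos_iff.2 (div_ne_zero two_ne_zero h2)
    rw [h6, pow_one, norm_smul, norm_mul] at h5
    refine le_of_mul_le_mul_left ?_ h7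
    linarith
  have hder : HasFDerivAt (fun x => wu (γ x))
      (wu.comp (AL.comp ((dconeL z₀).comp (p.prod (ContinuousLinearMap.id ℝ _))))) x₀ :=
    wu.hasFDerivAt.comp x₀ hγd
  have h0 := (eq_of_expansion_one hder hlo).2
  intro ξ
  exact DFunLike.congr_fun h0 ξ

theorem single_eq_sum (v : EX n) : v = ∑ i, v i • EuclideanSpace.single i (1 : ℝ) := by
  have := (EuclideanSpace.basisFun (Fin n) ℝ).sum_repr v
  simpa using this.symm

theorem bilin_eq_sum (B : EX n →L[ℝ] EX n →L[ℝ] ℝ) (v w : EX n) :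
    B v w = ∑ a, ∑ b, v a * w b *
      B (EuclideanSpace.single a 1) (EuclideanSpace.single b 1) := by
  conv_lhs => rw [single_eq_sum v, single_eq_sum w]
  simp only [map_sum, map_smul, sum_apply, smul_apply, smul_eq_mul, Finset.mul_sum]
  rw [Finset.sum_comm]
  refine Finset.sum_congr rfl fun a _ => Finset.sum_congr rfl fun b _ => ?_
  ring

/-- The coordinates of the image of the jet of a graph under an element of `SO(1, n+2)` which sends
its `1`-jet to that of the equator at the origin. -/
theorem exists_image_coords {g : SOW n} {S : Hyp n} {f : EX n → ℝ}
    (hS : S.pt ∈ (stereo n).source) (hf : IsGraphAt (stereo n) S.carrier S.pt f)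
    (hpt : actFun g S.pt = origin n)
    (htan : ∀ ξ, wu ((g : W n ≃ₗ[ℝ] W n) (dcone (stereoFun S.pt)
      (fderiv ℝ f (stereoFun S.pt).2 ξ, ξ))) = 0) :
    act g (jet 1 S) = o1 n ∧ ∃ (N : Matrix (Fin n) (Fin n) ℝ) (c k : ℝ), c ≠ 0 ∧ 0 < k ∧
      (N * N.transpose) * (k • (1 + Matrix.vecMulVec (grad f (stereoFun S.pt).2)
        (grad f (stereoFun S.pt).2))) = 1 ∧
      HasCoords (act g (jet 2 S)) 0 0 0
        (c • (N.transpose * hess f (stereoFun S.pt).2 * N) +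
          (wu ((g : W n ≃ₗ[ℝ] W n) eminus) *
            ((g : W n ≃ₗ[ℝ] W n) (cone (stereoFun S.pt))).1 / 8) • 1) := by
  obtain ⟨f', M, c, k, hgr, h0, h1, hc, hk, hM, h2⟩ := exists_image_graph hS hf hpt htan
  set μ := wu ((g : W n ≃ₗ[ℝ] W n) eminus) * ((g : W n ≃ₗ[ℝ] W n) (cone (stereoFun S.pt))).1 / 8
  have hpt' : (moveHyp g S).pt = origin n := hpt
  have hst : stereoFun (moveHyp g S).pt = (0, 0) := by rw [hpt', stereoFun_origin]
  constructor
  · refine Quot.sound ⟨hpt', stereo n, isSmoothChart_stereo n, ?_, f', fun _ => 0, ?_, ?_, ?_⟩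
    · rw [hpt']
      exact origin_mem_source
    · rw [hpt']
      exact hgr
    · rw [hpt']
      exact isGraphAt_fiducial
    · change SameJet 1 f' (fun _ => 0) (stereoFun (moveHyp g S).pt).2
      rw [hst, sameJet_one_iff]
      exact ⟨h0, by simp [h1]⟩
  · set P : Matrix (Fin n) (Fin n) ℝ := Matrix.of fun i j => M (EuclideanSpace.single j 1) i with hP
    set N : Matrix (Fin n) (Fin n) ℝ :=
      Matrix.of fun i j => M.symm (EuclideanSpace.single j 1) i with hN
    have hNP : N * P = 1 := by
      ext i j
      have h3 : M.symm (M (EuclideanSpace.single j 1)) = EuclideanSpace.single j (1 : ℝ) :=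
        M.symm_apply_apply _
      have h4 := congrArg (fun v : EX n => v i) h3
      rw [single_eq_sum (M (EuclideanSpace.single j 1)), map_sum] at h4
      simp only [map_smul, WithLp.ofLp_sum, Finset.sum_apply, PiLp.smul_apply, smul_eq_mul] at h4
      rw [Matrix.mul_apply]
      simp only [hN, hP, Matrix.of_apply]
      rw [Matrix.one_apply]
      simp only [mul_comm]
      rw [h4]
      simp
    have hPP : P.transpose * P = k • (1 + Matrix.vecMulVec (grad f (stereoFun S.pt).2)
        (grad f (stereoFun S.pt).2)) := by
      ext i j
      have h3 := hM (EuclideanSpace.single i 1) (EuclideanSpace.single j 1)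
      rw [PiLp.inner_apply] at h3
      rw [Matrix.mul_apply]
      simp only [hP, Matrix.transpose_apply, Matrix.of_apply, Matrix.smul_apply, Matrix.add_apply,
        Matrix.vecMulVec_apply, grad, smul_eq_mul, Matrix.one_apply]
      simp only [RCLike.inner_apply, conj_trivial] at h3
      rw [add_comm, show (if i = j then (1 : ℝ) else 0) =
        inner ℝ (EuclideanSpace.single i (1 : ℝ)) (EuclideanSpace.single j (1 : ℝ)) by
          simp [EuclideanSpace.inner_single_left], ← h3]
      exact Finset.sum_congr rfl fun a _ => mul_comm _ _
    refine ⟨N, c, k, hc, hk, ?_, ?_⟩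
    -- With `N = P⁻¹`, the product is `N Nᵀ Pᵀ P = N (P N)ᵀ P = N P = 1`.
    · rw [← hPP, ← Matrix.mul_assoc, Matrix.mul_assoc N, ← Matrix.transpose_mul,
        mul_eq_one_comm.1 hNP, Matrix.transpose_one, Matrix.mul_one, hNP]
    · rw [hasCoords_iff]
      refine ⟨moveHyp g S, f', rfl, ?_, hst, ?_, ?_, ?_⟩
      · rw [hpt']
        exact origin_mem_source
      · rw [hpt']
        exact hgr
      · funext i
        simp [grad, h1]
      · ext i j
        rw [hess, h2, bilin_eq_sum, Matrix.add_apply, Matrix.smul_apply, Matrix.smul_apply,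
          Matrix.mul_apply, Matrix.one_apply]
        congr 1
        · rw [smul_eq_mul, Finset.sum_comm]
          congr 1
          refine Finset.sum_congr rfl fun b _ => ?_
          rw [Matrix.mul_apply, Finset.sum_mul]
          refine Finset.sum_congr rfl fun a _ => ?_
          simp only [hN, Matrix.transpose_apply, Matrix.of_apply, hess]
          ring
        · simp [EuclideanSpace.inner_single_left]

end Coordinates

/-! ### Traces of powers and eigenvalues -/

section Newton

/-- Newton's identities express `k e_k` through the power sums and the `e_j` with `j < k`, and `k`
is invertible in `ℝ`. -/
theorem esymm_eq_of_psum_eq {n : ℕ} {a b : Fin n → ℝ}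
    (h : ∀ d, 1 ≤ d → d ≤ n → ∑ i, a i ^ d = ∑ i, b i ^ d) (k : ℕ) (hk : k ≤ n) :
    MvPolynomial.aeval a (MvPolynomial.esymm (Fin n) ℝ k) =
      MvPolynomial.aeval b (MvPolynomial.esymm (Fin n) ℝ k) := by
  induction k using Nat.strong_induction_on with
  | _ k ih =>
    rcases Nat.eq_zero_or_pos k with rfl | hk0
    · simp
    have key : ∀ c : Fin n → ℝ, (k : ℝ) * MvPolynomial.aeval c (MvPolynomial.esymm (Fin n) ℝ k) =
        (-1) ^ (k + 1) * ∑ x ∈ Finset.HasAntidiagonal.antidiagonal k with x.1 < k, (-1) ^ x.1 *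
          MvPolynomial.aeval c (MvPolynomial.esymm (Fin n) ℝ x.1) * ∑ i, c i ^ x.2 := by
      intro c
      have := congrArg (MvPolynomial.aeval c) (MvPolynomial.mul_esymm_eq_sum (Fin n) ℝ k)
      simpa [MvPolynomial.psum, map_sum] using this
    have hk1 : (k : ℝ) ≠ 0 := by exact_mod_cast hk0.ne'
    apply mul_left_cancel₀ hk1
    rw [key, key]
    congr 1
    refine Finset.sum_congr rfl fun x hx => ?_
    rw [Finset.mem_filter, Finset.HasAntidiagonal.mem_antidiagonal] at hx
    rw [ih x.1 hx.2 (by omega), h x.2 (by omega) (by omega)]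

theorem prod_X_sub_C_eq_of_psum_eq {n : ℕ} {a b : Fin n → ℝ}
    (h : ∀ d, 1 ≤ d → d ≤ n → ∑ i, a i ^ d = ∑ i, b i ^ d) :
    ∏ i, (Polynomial.X - Polynomial.C (a i)) = ∏ i, (Polynomial.X - Polynomial.C (b i)) := by
  have key : ∀ c : Fin n → ℝ, ∏ i, (Polynomial.X - Polynomial.C (c i)) =
      ∑ j ∈ Finset.range (n + 1), (-1) ^ j * (Polynomial.C (MvPolynomial.aeval c
        (MvPolynomial.esymm (Fin n) ℝ j)) * Polynomial.X ^ (n - j)) := by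
    intro c
    have := Multiset.prod_X_sub_X_eq_sum_esymm (Finset.univ.val.map c)
    simp only [Multiset.map_map, Multiset.card_map, Finset.card_val, Finset.card_univ,
      Fintype.card_fin, ← MvPolynomial.aeval_esymm_eq_multiset_esymm (Fin n) ℝ] at this
    exact this
  rw [key, key]
  refine Finset.sum_congr rfl fun j hj => ?_
  rw [Finset.mem_range] at hj
  rw [esymm_eq_of_psum_eq h j (by omega)]

theorem trace_pow_eq_sum_eigenvalues {n : ℕ} {A : Matrix (Fin n) (Fin n) ℝ}
    (hA : A.IsHermitian) (d : ℕ) : (A ^ d).trace = ∑ i, hA.eigenvalues i ^ d := by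
  conv_lhs => rw [hA.spectral_theorem]
  rw [← map_pow, Unitary.conjStarAlgAut_apply, Matrix.trace_mul_cycle]
  simp [Matrix.diagonal_pow, Matrix.trace_diagonal]

theorem charpoly_eq_of_trace_pow_eq {n : ℕ} {A B : Matrix (Fin n) (Fin n) ℝ}
    (hA : A.IsHermitian) (hB : B.IsHermitian)
    (h : ∀ d, 1 ≤ d → d ≤ n → (A ^ d).trace = (B ^ d).trace) : A.charpoly = B.charpoly := by
  rw [hA.charpoly_eq, hB.charpoly_eq]
  refine prod_X_sub_C_eq_of_psum_eq fun d h1 h2 => ?_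
  have := h d h1 h2
  rwa [trace_pow_eq_sum_eigenvalues hA, trace_pow_eq_sum_eigenvalues hB] at this

end Newton

/-! ### Trace-free parts, the metric `h` and the functions `τ_d`. -/

section TracePow

variable {n : ℕ}

/-- The traces of the powers of an endomorphism. -/
def tracePow (A : Matrix (Fin n) (Fin n) ℝ) (d : Finset.Icc 2 n) : ℝ := (A ^ (d : ℕ)).trace

theorem tau_eq (p : Fin n → ℝ) (U : Matrix (Fin n) (Fin n) ℝ) :
    tau p U = tracePow (traceFreePart (shape p U)) := rfl

theorem traceFreePart_coe (q : TraceFree n) : traceFreePart (q : Matrix (Fin n) (Fin n) ℝ) = q := by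
  have h : (q : Matrix (Fin n) (Fin n) ℝ).trace = 0 := q.2.2
  simp [traceFreePart, h]

theorem shape_zero (U : Matrix (Fin n) (Fin n) ℝ) : shape 0 U = U := by
  have : Matrix.vecMulVec (0 : Fin n → ℝ) (0 : Fin n → ℝ) = 0 := by
    ext
    simp [Matrix.vecMulVec_apply]
  simp [shape, hMetric, this]

theorem tau_zero (q : TraceFree n) :
    tau 0 (q : Matrix (Fin n) (Fin n) ℝ) = tracePow (q : Matrix (Fin n) (Fin n) ℝ) := by
  rw [tau_eq, shape_zero, traceFreePart_coe]

/-- Together with the vanishing trace, which supplies `d = 1`, the `τ_d` give all power sums up to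
`n`, hence the characteristic polynomial; the ordered eigenvalues are its sorted roots. -/
theorem eig_eq_of_tau_eq {q q' : TraceFree n}
    (h : tau 0 (q : Matrix (Fin n) (Fin n) ℝ) = tau 0 (q' : Matrix (Fin n) (Fin n) ℝ)) :
    eig q = eig q' := by
  rw [tau_zero, tau_zero] at h
  have hc : (q : Matrix (Fin n) (Fin n) ℝ).charpoly = (q' : Matrix (Fin n) (Fin n) ℝ).charpoly := by
    refine charpoly_eq_of_trace_pow_eq (TraceFree.isHermitian q) (TraceFree.isHermitian q')
      fun d h1 h2 => ?_
    rcases Nat.lt_or_eq_of_le h1 with h3 | rfl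
    · exact congrFun h ⟨d, Finset.mem_Icc.2 ⟨h3, h2⟩⟩
    · rw [pow_one, pow_one]
      exact q.2.2.trans q'.2.2.symm
  have he : (TraceFree.isHermitian q).eigenvalues₀ = (TraceFree.isHermitian q').eigenvalues₀ := by
    rw [← List.ofFn_inj, ← Matrix.IsHermitian.sort_roots_charpoly_eq_eigenvalues₀,
      ← Matrix.IsHermitian.sort_roots_charpoly_eq_eigenvalues₀, hc]
  funext i
  rw [eig, eig, he]

theorem exists_represents (f : (Fin n → ℝ) → ℝ) :
    ∃ F : (Finset.Icc 2 n → ℝ) → ℝ, Represents F f := by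
  have hfac : Function.FactorsThrough (fun q : TraceFree n => f (eig q))
      (fun q => tau 0 (q : Matrix (Fin n) (Fin n) ℝ)) :=
    fun q q' h => congrArg f (eig_eq_of_tau_eq h)
  -- Off the image of `q ↦ (τ_d)` the value is set to `0`.
  exact ⟨Function.extend _ _ 0, fun q => (hfac.extend_apply 0 q).symm⟩

theorem Represents.apply_tracePow {F : (Finset.Icc 2 n → ℝ) → ℝ} {f : (Fin n → ℝ) → ℝ}
    (h : Represents F f) (q : TraceFree n) :
    F (tracePow (q : Matrix (Fin n) (Fin n) ℝ)) = f (eig q) := by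
  rw [← tau_zero, h q]

theorem rot_one (q : TraceFree n) : rot 1 q = q := by
  apply Subtype.ext
  simp [rot]

/-- Negative factors come from `ℤ₂`, and the converse from the factor `c⁻¹`. This removes the
scalars that depend on the group element and the conformal factor between `h` and `N Nᵀ`. -/
theorem smul_mem_zeroSet_iff {f : (Fin n → ℝ) → ℝ} (hinv : IsCOZ2Invariant (zeroSet f))
    {c : ℝ} (hc : c ≠ 0) (q : TraceFree n) : c • q ∈ zeroSet f ↔ q ∈ zeroSet f := by
  have key : ∀ (c : ℝ), c ≠ 0 → ∀ q ∈ zeroSet f, c • q ∈ zeroSet f := by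
    intro c hc q hq
    rcases lt_or_gt_of_ne hc with h | h
    · have := (hinv q hq 1 (-c) (by linarith)).2
      have hneg : -((-c) • q) = c • q := Subtype.ext (by simp)
      rwa [rot_one, hneg] at this
    · have := (hinv q hq 1 c h).1
      rwa [rot_one] at this
  refine ⟨fun h => ?_, key c hc q⟩
  have := key c⁻¹ (inv_ne_zero hc) _ h
  rwa [smul_smul, inv_mul_cancel₀ hc, one_smul] at this

theorem trace_traceFreePart (hn : 1 ≤ n) (A : Matrix (Fin n) (Fin n) ℝ) :
    (traceFreePart A).trace = 0 := by
  have : (n : ℝ) ≠ 0 := by positivity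
  rw [traceFreePart, Matrix.trace_sub, Matrix.trace_smul, Matrix.trace_one, Fintype.card_fin,
    smul_eq_mul]
  field_simp
  ring

/-- Since `R` is the line of multiples of the identity, the trace-free part represents a class
modulo `R`. -/
theorem traceFreePart_add_smul_one (hn : 1 ≤ n) (A : Matrix (Fin n) (Fin n) ℝ) (m : ℝ) :
    traceFreePart (A + m • 1) = traceFreePart A := by
  have : (n : ℝ) ≠ 0 := by positivity
  rw [traceFreePart, traceFreePart, Matrix.trace_add, Matrix.trace_smul, Matrix.trace_one,
    Fintype.card_fin, smul_eq_mul, add_div, mul_div_cancel_right₀ _ this, add_smul]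
  abel

theorem traceFreePart_smul (c : ℝ) (A : Matrix (Fin n) (Fin n) ℝ) :
    traceFreePart (c • A) = c • traceFreePart A := by
  rw [traceFreePart, traceFreePart, Matrix.trace_smul, smul_sub, smul_smul, smul_eq_mul,
    mul_div_assoc]

/-- The trace-free part of a symmetric matrix as a trace-free quadratic form. -/
def toTraceFree (hn : 1 ≤ n) (A : Matrix (Fin n) (Fin n) ℝ) (hA : A.IsSymm) : TraceFree n :=
  ⟨traceFreePart A, hA.sub (Matrix.isSymm_one.smul _), trace_traceFreePart hn A⟩

theorem tracePow_traceFreePart_conj {S S' : Matrix (Fin n) (Fin n) ℝ} (hS : S' * S = 1) (c : ℝ)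
    (A : Matrix (Fin n) (Fin n) ℝ) : tracePow (c • traceFreePart (S * A * S')) =
      tracePow (c • traceFreePart A) := by
  have hS' : S * S' = 1 := mul_eq_one_comm.1 hS
  have h1 : c • traceFreePart (S * A * S') = S * (c • traceFreePart A) * S' := by
    rw [traceFreePart, traceFreePart, Matrix.mul_smul, Matrix.smul_mul, Matrix.mul_sub,
      Matrix.sub_mul, Matrix.mul_smul, Matrix.smul_mul, Matrix.mul_one, hS',
      Matrix.trace_mul_cycle, hS, Matrix.one_mul]
  funext d
  rw [tracePow, tracePow, h1]
  have h2 : ∀ k : ℕ, (S * (c • traceFreePart A) * S') ^ k =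
      S * (c • traceFreePart A) ^ k * S' := by
    intro k
    induction k with
    | zero => simp [hS']
    | succ k ih =>
      rw [pow_succ, ih, pow_succ]
      simp only [Matrix.mul_assoc]
      rw [← Matrix.mul_assoc S' S, hS, Matrix.one_mul]
  rw [h2, Matrix.trace_mul_cycle, hS, Matrix.one_mul]

/-- Sherman–Morrison: `(1 + p pᵀ)⁻¹ = 1 - ρ⁻¹ p pᵀ`, so `h` is `ρ⁻¹` times the inverse of the
Euclidean metric induced on the graph. -/
theorem hMetric_mul (p : Fin n → ℝ) :
    hMetric p * (1 + Matrix.vecMulVec p p) = (1 + ∑ i, p i ^ 2)⁻¹ • 1 := by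
  have hρ : 0 < 1 + ∑ i, p i ^ 2 := by positivity
  have hpp : Matrix.vecMulVec p p * Matrix.vecMulVec p p =
      (∑ i, p i ^ 2) • Matrix.vecMulVec p p := by
    rw [Matrix.vecMulVec_mul_vecMulVec]
    ext i j
    simp only [Matrix.vecMulVec_apply, Matrix.smul_apply, dotProduct, smul_eq_mul, Pi.smul_apply,
      pow_two]
    ring
  rw [hMetric, Matrix.smul_mul]
  have : ((1 + ∑ i, p i ^ 2) • (1 : Matrix (Fin n) (Fin n) ℝ) - Matrix.vecMulVec p p) *
      (1 + Matrix.vecMulVec p p) = (1 + ∑ i, p i ^ 2) • 1 := by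
    rw [Matrix.sub_mul, Matrix.smul_mul, Matrix.one_mul, Matrix.mul_add, Matrix.mul_one, hpp]
    module
  rw [this, smul_smul]
  congr 1
  field_simp

/-- Both `h` and `N Nᵀ` are multiples of `(1 + p pᵀ)⁻¹`, with factors `ρ⁻¹` and `k⁻¹`. -/
theorem shape_eq {p : Fin n → ℝ} {N : Matrix (Fin n) (Fin n) ℝ} {k : ℝ}
    (h : (N * N.transpose) * (k • (1 + Matrix.vecMulVec p p)) = 1)
    (U : Matrix (Fin n) (Fin n) ℝ) :
    shape p U = (k / (1 + ∑ i, p i ^ 2)) • (N * N.transpose * U) := by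
  have h1 : (k • (1 + Matrix.vecMulVec p p)) * (N * N.transpose) = 1 := mul_eq_one_comm.1 h
  have h2 : hMetric p = (k / (1 + ∑ i, p i ^ 2)) • (N * N.transpose) := by
    calc hMetric p = hMetric p * ((k • (1 + Matrix.vecMulVec p p)) * (N * N.transpose)) := by
          rw [h1, Matrix.mul_one]
      _ = k • ((hMetric p * (1 + Matrix.vecMulVec p p)) * (N * N.transpose)) := by
          rw [← Matrix.mul_assoc, Matrix.mul_smul, Matrix.smul_mul]
      _ = _ := by
          rw [hMetric_mul, Matrix.smul_mul, Matrix.one_mul, smul_smul, div_eq_mul_inv]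
  rw [shape, h2, Matrix.smul_mul]

theorem isUnit_of_mul_transpose {p : Fin n → ℝ} {N : Matrix (Fin n) (Fin n) ℝ} {k : ℝ}
    (h : (N * N.transpose) * (k • (1 + Matrix.vecMulVec p p)) = 1) :
    ∃ N' : Matrix (Fin n) (Fin n) ℝ, N' * N = 1 := by
  rw [Matrix.mul_assoc] at h
  exact ⟨_, mul_eq_one_comm.1 h⟩

/-- The equation in the invariants `τ_d` is the equation on the trace-free part of a symmetric matrix
obtained by the change of basis `N`. -/
theorem represents_tau_iff {F : (Finset.Icc 2 n → ℝ) → ℝ} {f : (Fin n → ℝ) → ℝ}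
    (hF : Represents F f) (hinv : IsCOZ2Invariant (zeroSet f)) (hn : 1 ≤ n) {p : Fin n → ℝ}
    {N : Matrix (Fin n) (Fin n) ℝ} {k : ℝ} (hk : 0 < k)
    (h : (N * N.transpose) * (k • (1 + Matrix.vecMulVec p p)) = 1)
    {U : Matrix (Fin n) (Fin n) ℝ} (hU : (N.transpose * U * N).IsSymm) :
    F (tau p U) = 0 ↔ toTraceFree hn _ hU ∈ zeroSet f := by
  obtain ⟨N', hN'⟩ := isUnit_of_mul_transpose h
  have hρ : 0 < 1 + ∑ i, p i ^ 2 := by positivity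
  -- The endomorphism `N Nᵀ U` is similar, through `N`, to the symmetric matrix `NᵀUN`, so the
  -- traces of the powers agree.
  have h1 : N * (N.transpose * U * N) * N' = N * N.transpose * U := by
    rw [Matrix.mul_assoc, Matrix.mul_assoc (N.transpose * U), mul_eq_one_comm.1 hN',
      Matrix.mul_one, Matrix.mul_assoc]
  have h2 : tau p U = tracePow
      (((k / (1 + ∑ i, p i ^ 2)) • toTraceFree hn _ hU : TraceFree n) :
        Matrix (Fin n) (Fin n) ℝ) := by
    rw [tau_eq, shape_eq h, traceFreePart_smul, ← h1, tracePow_traceFreePart_conj hN']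
    rfl
  rw [h2, hF.apply_tracePow]
  exact smul_mem_zeroSet_iff hinv (div_pos hk hρ).ne' _

end TracePow

/-! ### The fibre over `o⁽¹⁾` -/

section Fiber

variable {n : ℕ}

theorem act_mul {l : ℕ} (g h : SOW n) (j : Jet l n) : act g (act h j) = act (g * h) j := by
  induction j using Quot.ind with
  | mk S =>
    have hact : ∀ y : Sph n, actFun g (actFun h y) = actFun (g * h) y := by
      intro y
      have hl : (g : W n ≃ₗ[ℝ] W n) (lift (actFun h y)) = (((h : W n ≃ₗ[ℝ] W n) (lift y)).1)⁻¹ •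
          ((g * h : SOW n) : W n ≃ₗ[ℝ] W n) (lift y) := by
        rw [lift_actFun, map_smul]
        rfl
      apply Subtype.ext
      change (((g : W n ≃ₗ[ℝ] W n) (lift (actFun h y))).1)⁻¹ •
        ((g : W n ≃ₗ[ℝ] W n) (lift (actFun h y))).2 =
        ((((g * h : SOW n) : W n ≃ₗ[ℝ] W n) (lift y)).1)⁻¹ •
          (((g * h : SOW n) : W n ≃ₗ[ℝ] W n) (lift y)).2
      have hne := map_lift_ne h y
      rw [hl, Prod.smul_fst, Prod.smul_snd, smul_smul, smul_eq_mul, mul_inv, inv_inv, mul_right_comm,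
        mul_inv_cancel₀ hne, one_mul]
    have : moveHyp g (moveHyp h S) = moveHyp (g * h) S := by
      simp only [moveHyp, Set.image_image, hact]
    exact congrArg (jet l) this

theorem act_one {l : ℕ} (j : Jet l n) : act 1 j = j := by
  induction j using Quot.ind with
  | mk S =>
    have hact : ∀ y : Sph n, actFun 1 y = y := by
      intro y
      apply Subtype.ext
      change ((1 : ℝ))⁻¹ • (y : V n) = y
      simp
    have : moveHyp 1 S = S := by
      cases S
      simp [moveHyp, hact]
    exact congrArg (jet l) this

theorem proj_act (g : SOW n) (j : Jet 2 n) : proj (act g j) = act g (proj j) := by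
  induction j using Quot.ind with
  | mk S => rfl

theorem hasCoords_o2 : HasCoords (o2 n) 0 0 0 0 := by
  rw [hasCoords_iff]
  refine ⟨fiducial n, fun _ => 0, rfl, origin_mem_source, stereoFun_origin, isGraphAt_fiducial,
    ?_, ?_⟩
  · funext i
    simp [grad]
  · ext i k
    simp [hess]

theorem isDiff_o2_iff {j : Jet 2 n} {v : Matrix (Fin n) (Fin n) ℝ} :
    IsDiff j (o2 n) v ↔ HasCoords j 0 0 0 v := by
  constructor
  · rintro ⟨u, x, p, U, U', h, h', rfl⟩
    obtain ⟨rfl, rfl, rfl, rfl⟩ := h'.unique hasCoords_o2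
    rwa [sub_zero]
  · intro h
    exact ⟨0, 0, 0, v, 0, h, hasCoords_o2, (sub_zero v).symm⟩

theorem hasCoords_act {j : Jet 2 n} {u : ℝ} {x : EX n} {p : Fin n → ℝ}
    {U : Matrix (Fin n) (Fin n) ℝ} (h : HasCoords j u x p U) {g : SOW n}
    (hg : act g (proj j) = o1 n) :
    ∃ (N : Matrix (Fin n) (Fin n) ℝ) (c k m : ℝ), c ≠ 0 ∧ 0 < k ∧
      (N * N.transpose) * (k • (1 + Matrix.vecMulVec p p)) = 1 ∧
      HasCoords (act g j) 0 0 0 (c • (N.transpose * U * N) + m • 1) := by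
  obtain ⟨S, f, rfl, hS, hz, hf, rfl, rfl⟩ := hasCoords_iff.1 h
  obtain ⟨hpt, htan⟩ := tangent_of_act_eq hS hf hg
  obtain ⟨-, N, c, k, hc, hk, hN, hco⟩ := exists_image_coords hS hf hpt htan
  rw [hz] at hN hco
  exact ⟨N, c, k, _, hc, hk, hN, hco⟩

theorem exists_act_eq_o1 {j : Jet 2 n} {u : ℝ} {x : EX n} {p : Fin n → ℝ}
    {U : Matrix (Fin n) (Fin n) ℝ} (h : HasCoords j u x p U) :
    ∃ g : SOW n, act g (proj j) = o1 n := by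
  obtain ⟨S, f, rfl, hS, hz, hf, rfl, rfl⟩ := hasCoords_iff.1 h
  obtain ⟨g, hpt, htan⟩ := exists_map_tangent (stereoFun S.pt) (fderiv ℝ f (stereoFun S.pt).2)
  rw [show stereoInv (stereoFun S.pt) = S.pt from stereoInv_stereoFun hS] at hpt
  exact ⟨g, (exists_image_coords hS hf hpt htan).1⟩

theorem HasCoords.isSymm {j : Jet 2 n} {u : ℝ} {x : EX n} {p : Fin n → ℝ}
    {U : Matrix (Fin n) (Fin n) ℝ} (h : HasCoords j u x p U) : U.IsSymm := by
  obtain ⟨S, f, rfl, hS, hz, hf, rfl, rfl⟩ := hasCoords_iff.1 h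
  have h1 : ContDiffAt ℝ ∞ f (stereoFun S.pt).2 := hf.1.self_of_nhds
  rw [hz] at h1
  ext i k
  exact symm_fderiv_fderiv (h1.of_le two_le_infty) _ _

/-- The Hessian of the equator vanishes, so only the term `m • 1` of the transformation law
survives; null translations attain every `m`. -/
theorem fiberR_eq : fiberR n = {v | ∃ m : ℝ, v = m • 1} := by
  ext v
  constructor
  · rintro ⟨g, hg, hv⟩
    obtain ⟨N, c, k, m, -, -, -, hco⟩ := hasCoords_act hasCoords_o2 (g := g) hg
    refine ⟨m, ?_⟩
    have := ((isDiff_o2_iff.1 hv).unique hco).2.2.2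
    simpa using this
  · rintro ⟨m, rfl⟩
    -- The parameter `2 m` is chosen so that the coefficient of the identity, `2 m · 4 / 8`, is `m`:
    -- here `4` comes from `cone (0, 0) = 4 • eplus`.
    have hpt : actFun (nullTranslationSO (2 * m)) (fiducial n).pt = origin n := by
      have h1 : (((nullTranslationSO (2 * m) : SOW n) : W n ≃ₗ[ℝ] W n) (lift (origin n))) = eplus := by
        rw [nullTranslationSO_apply]
        change nullTranslation (2 * m) eplus = eplus
        simp [nullTranslation, eplus]
      apply Subtype.ext
      change ((((nullTranslationSO (2 * m) : SOW n) : W n ≃ₗ[ℝ] W n) (lift (origin n))).1)⁻¹ •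
        (((nullTranslationSO (2 * m) : SOW n) : W n ≃ₗ[ℝ] W n) (lift (origin n))).2 = _
      rw [h1]
      simp [eplus, origin]
    have hz : stereoFun (fiducial n).pt = (0, 0) := stereoFun_origin
    have hcone : ((nullTranslationSO (2 * m) : SOW n) : W n ≃ₗ[ℝ] W n) (cone (0, 0)) = (4 : ℝ) • eplus := by
      rw [nullTranslationSO_apply]
      refine ext_W ?_ ?_ ?_ ?_ <;>
        simp [fst_nullTranslation, cu_nullTranslation, cx_nullTranslation, ct_nullTranslation, cone,
          eplus, cu_smul, cx_smul, ct_smul]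
    have hem : wu (((nullTranslationSO (2 * m) : SOW n) : W n ≃ₗ[ℝ] W n) eminus) = 2 * m := by
      rw [nullTranslationSO_apply, wu_apply, cu_nullTranslation]
      simp [eminus]
      ring
    have htan : ∀ ξ, wu (((nullTranslationSO (2 * m) : SOW n) : W n ≃ₗ[ℝ] W n)
        (dcone (stereoFun (fiducial n).pt)
          (fderiv ℝ (fun _ : EX n => (0 : ℝ)) (stereoFun (fiducial n).pt).2 ξ, ξ))) = 0 := by
      intro ξ
      rw [nullTranslationSO_apply, wu_apply, cu_nullTranslation, hz]
      simp [dcone]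
    obtain ⟨h1, N, c, k, -, -, -, hco⟩ :=
      exists_image_coords (f := fun _ => 0) (origin_mem_source (n := n)) isGraphAt_fiducial hpt htan
    have hh : hess (fun _ : EX n => (0 : ℝ)) (stereoFun (fiducial n).pt).2 = 0 := by
      ext i k
      simp [hess]
    refine ⟨nullTranslationSO (2 * m), h1, ?_⟩
    have h4 : (2 * m) * ((4 : ℝ) • (eplus : W n)).1 / 8 = m := by
      simp [eplus]
      ring
    rw [hh, hz, hcone, hem, h4, Matrix.mul_zero, Matrix.zero_mul, smul_zero, zero_add] at hco
    exact isDiff_o2_iff.2 hco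

theorem inFiber_iff (hn : 1 ≤ n) {f : (Fin n → ℝ) → ℝ} {j : Jet 2 n}
    {V : Matrix (Fin n) (Fin n) ℝ} (h : HasCoords j 0 0 0 V) :
    InFiber (zeroSet f) j ↔ toTraceFree hn V h.isSymm ∈ zeroSet f := by
  constructor
  · rintro ⟨q, hq, r, hr, hd⟩
    rw [fiberR_eq] at hr
    obtain ⟨m, rfl⟩ := hr
    have hV := ((isDiff_o2_iff.1 hd).unique h).2.2.2
    have : toTraceFree hn V h.isSymm = q := by
      apply Subtype.ext
      change traceFreePart V = q
      rw [← hV, traceFreePart_add_smul_one hn, traceFreePart_coe]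
    rwa [this]
  · intro hq
    refine ⟨_, hq, (V.trace / n) • 1, ?_, ?_⟩
    · rw [fiberR_eq]
      exact ⟨_, rfl⟩
    · rw [isDiff_o2_iff]
      have : ((toTraceFree hn V h.isSymm : TraceFree n) : Matrix (Fin n) (Fin n) ℝ) +
          (V.trace / n) • 1 = V := sub_add_cancel _ _
      rwa [this]

/-- The condition defining the equation, read in the coordinates of a jet. -/
theorem inFiber_act_iff (hn : 1 ≤ n) {f : (Fin n → ℝ) → ℝ} (hinv : IsCOZ2Invariant (zeroSet f))
    {F : (Finset.Icc 2 n → ℝ) → ℝ} (hF : Represents F f) {j : Jet 2 n} {u : ℝ} {x : EX n}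
    {p : Fin n → ℝ} {U : Matrix (Fin n) (Fin n) ℝ} (h : HasCoords j u x p U) {g : SOW n}
    (hg : act g (proj j) = o1 n) : InFiber (zeroSet f) (act g j) ↔ F (tau p U) = 0 := by
  obtain ⟨N, c, k, m, hc, hk, hN, hco⟩ := hasCoords_act h hg
  have hU : (N.transpose * U * N).IsSymm := by
    rw [Matrix.IsSymm, Matrix.transpose_mul, Matrix.transpose_mul, Matrix.transpose_transpose,
      h.isSymm.eq, Matrix.mul_assoc]
  rw [inFiber_iff hn hco, represents_tau_iff hF hinv hn hk hN hU]
  have : toTraceFree hn _ hco.isSymm = c • toTraceFree hn _ hU := by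
    apply Subtype.ext
    change traceFreePart _ = c • traceFreePart _
    rw [traceFreePart_add_smul_one hn, traceFreePart_smul]
  rw [this]
  exact smul_mem_zeroSet_iff hinv hc _

/-- The jet `j` may have no stereographic coordinates, for instance over `-o`, so the comparison is
made on `act g' j`, which lies over `o⁽¹⁾`. Both `g * g'⁻¹` and `1` send its 1-jet to `o⁽¹⁾`, and
both conditions amount to the same equation `F (tau 0 V) = 0`. -/
theorem mem_PDE_iff (hn : 1 ≤ n) {f : (Fin n → ℝ) → ℝ} (hinv : IsCOZ2Invariant (zeroSet f))
    {j : Jet 2 n} {g : SOW n} (hg : act g (proj j) = o1 n) :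
    j ∈ PDE (zeroSet f) ↔ InFiber (zeroSet f) (act g j) := by
  refine ⟨?_, fun h => ⟨g, hg, h⟩⟩
  rintro ⟨g', hg', h⟩
  obtain ⟨F, hF⟩ := exists_represents f
  have hco : ∃ V, HasCoords (act g' j) 0 0 0 V := by
    obtain ⟨q, -, r, -, hd⟩ := h
    exact ⟨_, isDiff_o2_iff.1 hd⟩
  obtain ⟨V, hco⟩ := hco
  have h1 : act (g * g'⁻¹) (act g' j) = act g j := by rw [act_mul, inv_mul_cancel_right]
  have h2 : act (g * g'⁻¹) (proj (act g' j)) = o1 n := by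
    rw [proj_act, act_mul, inv_mul_cancel_right, hg]
  have h3 : act 1 (proj (act g' j)) = o1 n := by rw [proj_act, act_one, hg']
  rw [← h1, inFiber_act_iff hn hinv hF hco h2, ← inFiber_act_iff hn hinv hF hco h3, act_one]
  exact h

theorem act_mem_PDE {s : Set (TraceFree n)} {j : Jet 2 n} (g : SOW n) (h : j ∈ PDE s) :
    act g j ∈ PDE s := by
  obtain ⟨g', hg', h⟩ := h
  refine ⟨g' * g⁻¹, ?_, ?_⟩
  · rw [proj_act, act_mul, inv_mul_cancel_right, hg']
  · rwa [act_mul, inv_mul_cancel_right]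

end Fiber

end ConfPDE

end

/-! ### The main theorem. -/

open ConfPDE
theorem mainTheorem8 (n : ℕ) (hn : 1 ≤ n) (f : (Fin n → ℝ) → ℝ)
    (hinv : IsCOZ2Invariant (zeroSet f)) :
    ((∃ F : (Finset.Icc 2 n → ℝ) → ℝ, Represents F f) ∧
      ∀ F F' : (Finset.Icc 2 n → ℝ) → ℝ, Represents F f → Represents F' f →
        ∀ q : TraceFree n, F (tau 0 (q : Matrix (Fin n) (Fin n) ℝ)) =
          F' (tau 0 (q : Matrix (Fin n) (Fin n) ℝ))) ∧
    (∀ (j : Jet 2 n) (g : SOW n), act g (proj j) = o1 n →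
      (j ∈ PDE (zeroSet f) ↔ InFiber (zeroSet f) (act g j))) ∧
    (∀ (j : Jet 2 n) (g : SOW n), j ∈ PDE (zeroSet f) → act g j ∈ PDE (zeroSet f)) ∧
    ∀ F : (Finset.Icc 2 n → ℝ) → ℝ, Represents F f →
      ∀ (j : Jet 2 n) (u : ℝ) (x : EX n) (p : Fin n → ℝ) (U : Matrix (Fin n) (Fin n) ℝ),
        HasCoords j u x p U → (j ∈ PDE (zeroSet f) ↔ F (tau p U) = 0) := by
  refine ⟨⟨exists_represents f, fun F F' h h' q => (h q).symm.trans (h' q)⟩,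
    fun j g hg => mem_PDE_iff hn hinv hg, fun j g h => act_mem_PDE g h, ?_⟩
  intro F hF j u x p U h
  obtain ⟨g, hg⟩ := exists_act_eq_o1 h
  rw [mem_PDE_iff hn hinv hg, inFiber_act_iff hn hinv hF h hg]
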